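/- **Theorem (Calibration consistency).** *Setup.* Let $0<q<1$. For a weight profile $w=(w_1,\dots,w_n)$, $w_i>0$, put $\tilde w_i=w_i/\sum_j w_j$ and $n_{\mathrm{eff}}=(\sum_i w_i)^2/\sum_i w_i^2$. For scores $\rho=(\rho_1,\dots,\rho_n)\in\mathbb R^n$ let $\rho_{(1)}\le\dots\le\rho_{(n)}$ be the sorted scores, $\tilde w_{(1)},\dots,\tilde w_{(n)}$ the normalized weights in the same order, and $p_j=\sum_{i\le j}\tilde w_{(i)}$. Let $\hat F_w(t)=\sum_i\tilde w_i\mathbf 1[\rho_i\le t]$ and $\lambda_{\mathrm{WCP}}=\inf\{t:\hat F_w(t)\ge q\}$ (the weighted conformal threshold). For $c>0$ let $V\sim\mathrm{Dir}(c\,\tilde w_{(1)},\dots,c\,\tilde w_{(n)})$, $S_j=V_1+\dots+V_j$, $K=\min\{j:S_j\ge q\}$ and $\lambda_{\mathrm{post}}=\rho_{(K)}$. The law of $V$, for given $\rho$ and $w$, is called the posterior, with variance $\mathrm{Var}_c$; in the frequentist statements the weight profile is fixed and the scores are drawn independently from one probability law $P$ on $\mathbb R$ with distribution function $F$. 1.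 **Mean consistency.** If $\hat F_w(\lambda_{\mathrm{WCP}})\ne q$, there is a constant $C$ depending only on $\rho,w,q$ such that $|\mathbb E[\lambda_{\mathrm{post}}]-\lambda_{\mathrm{WCP}}|\le C/c$ for all $c>0$. 2. **Variance calibration.** (a) $\mathrm{Var}_c(S_j)=p_j(1-p_j)/(c+1)$ for all $c>0$ and all $j$. (b) $\mathrm{Var}_{\mathrm{freq}}(\hat F_w(t))=F(t)(1-F(t))/n_{\mathrm{eff}}$ for all $t$; and for any (test) law with distribution function $G$, $|\mathrm{Var}_{\mathrm{freq}}(\hat F_w(t))-G(t)(1-G(t))/n_{\mathrm{eff}}|\le|F(t)-G(t)|/n_{\mathrm{eff}}$. (c) If $p_j=F(t)\in(0,1)$, then for $c>0$: $\mathrm{Var}_c(S_j)=\mathrm{Var}_{\mathrm{freq}}(\hat F_w(t))$ if and only if $c=n_{\mathrm{eff}}-1$, and $\mathrm{Var}_c(S_j)<\mathrm{Var}_{\mathrm{freq}}(\hat F_w(t))$ if and only if $c>n_{\mathrm{eff}}-1$; for $c=n_{\mathrm{eff}}$ the two variances differ by at most $\mathrm{Var}_{\mathrm{freq}}(\hat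 F_w(t))/n_{\mathrm{eff}}$. (d) Consider any sequence of weight profiles $w^{(k)}$ (of any sizes) with $n_{\mathrm{eff}}^{(k)}\to\infty$, any scores $\rho^{(k)}$, any $c_k>0$, and a point $\lambda^*$ with $F(\lambda^*)=q$; let $k^*=\min\{j:p_j\ge q\}$. Then $\mathrm{Var}_{c_k}(S_{k^*})/\mathrm{Var}_{\mathrm{freq}}(\hat F_w(\lambda^*))\to1$ if and only if $c_k/n_{\mathrm{eff}}^{(k)}\to1$. 3. **Bernstein–von Mises alignment.** Let $w^{(k)}$ be a sequence of weight profiles with $n_{\mathrm{eff}}^{(k)}\to\infty$, let $F(\lambda^*)=q$, and let $F$ be differentiable at $\lambda^*$ with $F'(\lambda^*)=f>0$. Write $\sigma^2=q(1-q)/f^2$ and drop the index $k$. (a) Under the sampling law, $\sqrt{n_{\mathrm{eff}}}\,(\lambda_{\mathrm{WCP}}-\lambda^*)$ has asymptotic mean $0$ and asymptotic variance $\sigma^2$: its mean and second moment, truncated at level $M$, tend to $0$ and $\sigma^2$ as first $k\to\infty$ and then $M\to\infty$. If moreover $\sqrt{n_{\mathrm{eff}}}\max_i\tilde w_i\to0$,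 it converges in law to $N(0,\sigma^2)$. (b) With $c=n_{\mathrm{eff}}$, the posterior law of $\sqrt{n_{\mathrm{eff}}}\,(\lambda_{\mathrm{post}}-\lambda_{\mathrm{WCP}})$ converges weakly to $N(0,\sigma^2)$, in probability over the scores. (c) For other concentrations $c_k>0$: if $c_k/n_{\mathrm{eff}}\to\kappa\in(0,\infty)$, the limit of this posterior law is $N(0,\sigma^2/\kappa)$, so that the posterior is too concentrated for $\kappa>1$ and too diffuse for $\kappa<1$; if $c_k/n_{\mathrm{eff}}\to\infty$, then for every $x>0$ the posterior probability of $\sqrt{n_{\mathrm{eff}}}\,|\lambda_{\mathrm{post}}-\lambda_{\mathrm{WCP}}|\le x$ tends to $1$ in probability; if $c_k/n_{\mathrm{eff}}\to0$, it tends to $0$ in probability for every $x>0$. -/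

import Mathlib

open MeasureTheory ProbabilityTheory Filter Topology

noncomputable section

namespace WBCP

/-- Normalized weights `w̃ i = w i / ∑ j, w j`. -/
def normWeight {n : ℕ} (w : Fin n → ℝ) (i : Fin n) : ℝ := w i / ∑ j, w j

/-- Kish's effective sample size. -/
def nEff {n : ℕ} (w : Fin n → ℝ) : ℝ := (∑ i, w i) ^ 2 / ∑ i, w i ^ 2

/-- The order statistics of the scores `ρ` (indices start at `0`). -/
def sortedScore {n : ℕ} (ρ : Fin n → ℝ) (j : Fin n) : ℝ := ρ (Tuple.sort ρ j)

/-- The normalized weights, listed in the order of the sorted scores. -/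
def sortedWeight {n : ℕ} (ρ w : Fin n → ℝ) (j : Fin n) : ℝ := normWeight w (Tuple.sort ρ j)

/-- Cumulative sums `v 0 + ⋯ + v j`. -/
def cumSum {n : ℕ} (v : Fin n → ℝ) (j : Fin n) : ℝ := ∑ i ∈ Finset.Iic j, v i

/-- The first index at which the cumulative sums of `v` reach the level `q` (the infimum is taken in
the finite linear order `Fin n`, so it is a minimum whenever the level is reached). -/
def firstCrossing {n : ℕ} [NeZero n] (q : ℝ) (v : Fin n → ℝ) : Fin n :=
  sInf {j | q ≤ cumSum v j}

/-- The Dirichlet distribution with parameters `α i > 0`: the law of a vector of independent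
`Gamma(α i, 1)` variables divided by its sum. -/
def dirichlet {n : ℕ} (α : Fin n → ℝ) : Measure (Fin n → ℝ) :=
  (Measure.pi fun i => gammaMeasure (α i) 1).map fun g i => g i / ∑ j, g j

/-- The weighted Dirichlet model with concentration `c`: the law of
`V ~ Dir(c * w̃_(1), …, c * w̃_(n))`, given scores `ρ` and weights `w`. -/
def posterior {n : ℕ} (ρ w : Fin n → ℝ) (c : ℝ) : Measure (Fin n → ℝ) :=
  dirichlet fun j => c * sortedWeight ρ w j

/-- The threshold `ρ_(K)`, `K = min {j | V_1 + ⋯ + V_j ≥ q}`, as a function of `V = v`. Its law under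
`posterior ρ w c` is the posterior of the threshold. -/
def postThreshold {n : ℕ} [NeZero n] (ρ : Fin n → ℝ) (q : ℝ) (v : Fin n → ℝ) : ℝ :=
  sortedScore ρ (firstCrossing q v)

/-- The weighted empirical distribution function `∑ i, w̃ i * 1[ρ i ≤ t]`. -/
def weightedCDF {n : ℕ} (w ρ : Fin n → ℝ) (t : ℝ) : ℝ :=
  ∑ i, normWeight w i * (Set.Iic t).indicator 1 (ρ i)

/-- The threshold of weighted conformal prediction: the weighted `q`-quantile of the scores. -/
def wcpThreshold {n : ℕ} (w ρ : Fin n → ℝ) (q : ℝ) : ℝ := sInf {t | q ≤ weightedCDF w ρ t}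

/-- The sampling law of `n` independent scores with common law `P`. -/
def sampling (n : ℕ) (P : Measure ℝ) : Measure (Fin n → ℝ) := Measure.pi fun _ => P

/-- Frequentist variance of the weighted empirical distribution function at `t`, for a given weight
profile `w` and independent scores with law `P`. -/
def freqVar {n : ℕ} (w : Fin n → ℝ) (P : Measure ℝ) (t : ℝ) : ℝ :=
  variance (fun ρ => weightedCDF w ρ t) (sampling n P)

/-- Posterior variance of the cumulative sum `S_j`. -/
def postVar {n : ℕ} (ρ w : Fin n → ℝ) (c : ℝ) (j : Fin n) : ℝ :=
  variance (fun v => cumSum v j) (posterior ρ w c)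

/-- The error of the posterior threshold around the weighted-CP threshold, on the scale
`1 / √n_eff`. -/
def postError {n : ℕ} [NeZero n] (w ρ : Fin n → ℝ) (q : ℝ) (v : Fin n → ℝ) : ℝ :=
  √(nEff w) * (postThreshold ρ q v - wcpThreshold w ρ q)

/-- The sampling error of the weighted sample quantile around `θ`, on the scale `1 / √n_eff`. -/
def freqError {n : ℕ} (w : Fin n → ℝ) (q θ : ℝ) (ρ : Fin n → ℝ) : ℝ :=
  √(nEff w) * (wcpThreshold w ρ q - θ)

/-- `X k`, a function of the `k`-th calibration sample, tends to the constant `a` in probability. -/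
def TendstoInProb (m : ℕ → ℕ) (P : Measure ℝ) (X : ∀ k, (Fin (m k) → ℝ) → ℝ) (a : ℝ) : Prop :=
  ∀ ε > 0, Tendsto (fun k => sampling (m k) P {ρ | ε ≤ |X k ρ - a|}) atTop (𝓝 0)

/-- The (already rescaled and centred) variables `X k` have asymptotic mean `0` and asymptotic
variance `s`: the mean and the second moment of `X k`, truncated at the level `M`, tend to `0` and
`s` as first `k → ∞` and then `M → ∞`. The laws of `X k` are then asymptotically tight, and every
weak limit along a subsequence has mean `0` and variance `s`. -/
def HasAsymptoticVariance (m : ℕ → ℕ) (P : Measure ℝ) (X : ∀ k, (Fin (m k) → ℝ) → ℝ)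
    (s : ℝ) : Prop :=
  ∀ ε > 0, ∃ M₀ : ℝ, ∀ M ≥ M₀, ∀ᶠ k in atTop,
    |∫ ρ, max (-M) (min M (X k ρ)) ∂(sampling (m k) P)| ≤ ε ∧
    |∫ ρ, min (M ^ 2) (X k ρ ^ 2) ∂(sampling (m k) P) - s| ≤ ε

end WBCP

end

/-!
The posterior threshold is at most `t` exactly when the Dirichlet mass of the scores up to `t`
reaches `q`. This mass is a ratio of gamma variables, hence has the law `Beta(c p, c (1 - p))` with
`p = weightedCDF w ρ t`. Its variance `p (1 - p) / (c + 1)` gives the calibration statements, and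
with Chebyshev's inequality at the finitely many scores it gives mean consistency.

For the asymptotics, the weighted empirical distribution function is followed at the points
`θ + y / √n_eff`. Its increments from `θ` have variance `O(1 / n_eff ^ (3 / 2))`, so on the scale
`1 / √n_eff` it is, uniformly for bounded `y` by monotonicity, its value at `θ` plus `f y`.
This is Bahadur's linearization of the weighted sample quantile: the sampling statements reduce to
the variance and the central limit theorem for the empirical distribution function at `θ`, and
around the quantile itself the function is `q + f x / √n_eff` up to a negligible error, whatever the
sample. A central limit theorem for `Beta(c p, c (1 - p))` with `√c (p - q)` convergent then gives
the limit of the posterior; when `c / n_eff → ∞` Chebyshev's inequality replaces it, and when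
`c / n_eff → 0` an anticoncentration bound for the gamma law does.
-/

namespace WBCP

section GammaBeta

variable {a b r : ℝ}

lemma measurable_gammaPDF (a r : ℝ) : Measurable (gammaPDF a r) :=
  (measurable_gammaPDFReal a r).ennreal_ofReal

lemma ae_pos_gammaMeasure (a r : ℝ) : ∀ᵐ x ∂gammaMeasure a r, 0 < x := by
  rw [gammaMeasure, ae_withDensity_iff (measurable_gammaPDF a r)]
  filter_upwards [volume.ae_ne 0] with x hx0 hx
  exact lt_of_le_of_ne (not_lt.1 fun h => hx (gammaPDF_of_neg h)) hx0.symm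

lemma integral_gammaMeasure {E : Type*} [NormedAddCommGroup E] [NormedSpace ℝ E] (ha : 0 < a)
    (hr : 0 < r) (f : ℝ → E) :
    ∫ x, f x ∂gammaMeasure a r =
      ∫ x in Set.Ioi 0, (r ^ a / Real.Gamma a * x ^ (a - 1) * Real.exp (-(r * x))) • f x := by
  rw [← Measure.restrict_eq_self_of_ae_mem (ae_pos_gammaMeasure a r), gammaMeasure]
  change ∫ x in Set.Ioi 0, f x ∂_ = _
  rw [restrict_withDensity measurableSet_Ioi, integral_withDensity_eq_integral_toReal_smul
    (measurable_gammaPDF a r) (ae_of_all _ fun _ => ENNReal.ofReal_lt_top)]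
  refine setIntegral_congr_fun measurableSet_Ioi fun x (hx : 0 < x) => ?_
  have := Real.Gamma_pos_of_pos ha
  simp only [gammaPDF_of_nonneg hx.le]
  rw [ENNReal.toReal_ofReal (by positivity)]

lemma mgf_gammaMeasure (ha : 0 < a) (hr : 0 < r) {t : ℝ} (ht : t < r) :
    mgf id (gammaMeasure a r) t = (1 - t / r) ^ (-a) := by
  have hrt : 0 < r - t := sub_pos.2 ht
  have hG := (Real.Gamma_pos_of_pos ha).ne'
  calc mgf id (gammaMeasure a r) t
      = ∫ x in Set.Ioi 0, r ^ a / Real.Gamma a * (x ^ (a - 1) * Real.exp (-((r - t) * x))) := by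
        rw [mgf, integral_gammaMeasure ha hr]
        refine setIntegral_congr_fun measurableSet_Ioi fun x _ => ?_
        simp only [id, smul_eq_mul, mul_assoc, ← Real.exp_add]
        ring_nf
    _ = r ^ a * (1 / (r - t)) ^ a := by
        rw [integral_const_mul, Real.integral_rpow_mul_exp_neg_mul_Ioi ha hrt]
        field_simp
    _ = (1 - t / r) ^ (-a) := by
        rw [← Real.mul_rpow hr.le (by positivity), mul_one_div, Real.rpow_neg_eq_inv_rpow,
          one_sub_div hr.ne', inv_div]

lemma integrable_exp_mul_gammaMeasure (ha : 0 < a) (hr : 0 < r) {t : ℝ} (ht : t < r) :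
    Integrable (fun x => Real.exp (t * x)) (gammaMeasure a r) := by
  refine .of_integral_ne_zero ?_
  have h := mgf_gammaMeasure ha hr ht
  simp only [mgf, id] at h
  rw [h]
  exact (Real.rpow_pos_of_pos (by rw [sub_pos, div_lt_one hr]; exact ht) _).ne'

lemma complexMGF_gammaMeasure (ha : 0 < a) (hr : 0 < r) {z : ℂ} (hz : z.re < r) :
    complexMGF id (gammaMeasure a r) z = (1 - z / r) ^ (-a : ℂ) := by
  have hslit : ∀ z : ℂ, z.re < r → 1 - z / r ∈ Complex.slitPlane := fun z hz => by
    left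
    simpa [Complex.div_ofReal_re, div_lt_one hr] using hz
  have hmgf : AnalyticOnNhd ℂ (complexMGF id (gammaMeasure a r)) {z | z.re < r} :=
    analyticOnNhd_complexMGF.mono fun z (hz : z.re < r) =>
      interior_maximal (fun t ht => integrable_exp_mul_gammaMeasure ha hr ht) isOpen_Iio hz
  have hpow : AnalyticOnNhd ℂ (fun z : ℂ => (1 - z / r) ^ (-a : ℂ)) {z | z.re < r} := fun z hz =>
    AnalyticAt.cpow (by fun_prop) (by fun_prop) (hslit z hz)
  have hreal : ∀ᶠ t : ℝ in 𝓝[≠] 0,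
      complexMGF id (gammaMeasure a r) t = (1 - (t : ℂ) / r) ^ (-a : ℂ) := by
    filter_upwards [mem_nhdsWithin_of_mem_nhds (Iio_mem_nhds hr)] with t (ht : t < r)
    have : 0 ≤ 1 - t / r := by rw [sub_nonneg, div_le_one hr]; exact ht.le
    rw [complexMGF_ofReal, mgf_gammaMeasure ha hr ht, Complex.ofReal_cpow this]
    push_cast
    rfl
  have hcoe : Tendsto ((↑) : ℝ → ℂ) (𝓝[≠] 0) (𝓝[≠] 0) :=
    tendsto_nhdsWithin_iff.2 ⟨(Complex.continuous_ofReal.tendsto' 0 0 rfl).mono_left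
      nhdsWithin_le_nhds, by
        filter_upwards [self_mem_nhdsWithin] with t ht using Complex.ofReal_ne_zero.2 ht⟩
  exact hmgf.eqOn_of_preconnected_of_frequently_eq hpow (convex_halfSpace_re_lt r).isPreconnected
    (show (0 : ℂ).re < r by simpa) (hcoe.frequently hreal.frequently) hz

lemma charFun_gammaMeasure (ha : 0 < a) (hr : 0 < r) (t : ℝ) :
    charFun (gammaMeasure a r) t = (1 - t * Complex.I / r) ^ (-a : ℂ) := by
  rw [← complexMGF_id_mul_I, complexMGF_gammaMeasure ha hr (by simpa)]

-- The density of a product of gamma laws in the coordinates `u = x / (x + y)` and `t = x + y`,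
-- whose Jacobian is `t`.
lemma gammaPDF_mul_gammaPDF (ha : 0 < a) (hb : 0 < b) (hr : 0 < r) {t u : ℝ} (ht : 0 < t)
    (hu0 : u ≠ 0) (hu1 : u ≠ 1) :
    ENNReal.ofReal t * (gammaPDF a r (t * u) * gammaPDF b r (t - t * u))
      = betaPDF a b u * gammaPDF (a + b) r t := by
  rcases hu0.lt_or_gt with h0 | h0
  · rw [gammaPDF_of_neg (mul_neg_of_pos_of_neg ht h0), betaPDF_eq_zero_of_nonpos h0.le]
    simp
  rcases hu1.lt_or_gt with h1 | h1
  · have h1u : 0 < 1 - u := sub_pos.2 h1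
    have htu : 0 < t - t * u := by nlinarith
    have hB := beta_pos ha hb
    rw [gammaPDF_of_nonneg (by positivity), gammaPDF_of_nonneg htu.le, gammaPDF_of_nonneg ht.le,
      betaPDF_of_pos_lt_one h0 h1, ← ENNReal.ofReal_mul (by positivity),
      ← ENNReal.ofReal_mul (by positivity), ← ENNReal.ofReal_mul (by positivity)]
    congr 1
    have hexp : Real.exp (-(r * t))
        = Real.exp (-(r * (t * u))) * Real.exp (-(r * (t - t * u))) := by
      rw [← Real.exp_add]; ring_nf
    have hpow : t ^ (a + b - 1) = t * (t ^ (a - 1) * t ^ (b - 1)) := by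
      rw [← Real.rpow_add ht, mul_comm, ← Real.rpow_add_one ht.ne']; ring_nf
    have hGa := (Real.Gamma_pos_of_pos ha).ne'
    have hGb := (Real.Gamma_pos_of_pos hb).ne'
    have hGab := (Real.Gamma_pos_of_pos (add_pos ha hb)).ne'
    rw [hexp, hpow, Real.rpow_add hr, show t - t * u = t * (1 - u) by ring,
      Real.mul_rpow ht.le h0.le, Real.mul_rpow ht.le h1u.le, beta]
    field_simp
  · rw [gammaPDF_of_neg (x := t - t * u) (by nlinarith), betaPDF_eq_zero_of_one_le h1.le]
    simp

lemma lintegral_comp_mul_left {t : ℝ} (ht : 0 < t) {f : ℝ → ENNReal} (hf : Measurable f) :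
    ∫⁻ x, f x = ∫⁻ u, ENNReal.ofReal t * f (t * u) := by
  nth_rw 1 [← Real.smul_map_volume_mul_left ht.ne']
  rw [lintegral_smul_measure, lintegral_map hf (by fun_prop), abs_of_pos ht,
    lintegral_const_mul _ (by fun_prop), smul_eq_mul]

lemma map_prodMk_div_add_gammaMeasure (ha : 0 < a) (hb : 0 < b) (hr : 0 < r) :
    ((gammaMeasure a r).prod (gammaMeasure b r)).map (fun x => (x.1 / (x.1 + x.2), x.1 + x.2))
      = (betaMeasure a b).prod (gammaMeasure (a + b) r) := by
  have hγ := fun a => measurable_gammaPDF a r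
  have hβ : Measurable (betaPDF a b) := (measurable_betaPDFReal a b).ennreal_ofReal
  refine Measure.ext_of_lintegral _ fun F hF => ?_
  rw [lintegral_map hF (by fun_prop), gammaMeasure, gammaMeasure, gammaMeasure, betaMeasure,
    prod_withDensity (hγ a) (hγ b), prod_withDensity hβ (hγ (a + b)),
    lintegral_withDensity_eq_lintegral_mul _ (by fun_prop) (by fun_prop),
    lintegral_withDensity_eq_lintegral_mul _ (by fun_prop) hF,
    lintegral_prod _ (by fun_prop), lintegral_prod_symm _ (by fun_prop)]
  simp only [Pi.mul_apply]
  calc ∫⁻ x, ∫⁻ y, gammaPDF a r x * gammaPDF b r y * F (x / (x + y), x + y)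
      = ∫⁻ x, ∫⁻ t, gammaPDF a r x * gammaPDF b r (t - x) * F (x / t, t) := by
        refine lintegral_congr fun x => ?_
        rw [← lintegral_sub_right_eq_self _ x]
        simp only [add_sub_cancel]
    _ = ∫⁻ t, ∫⁻ x, gammaPDF a r x * gammaPDF b r (t - x) * F (x / t, t) :=
        lintegral_lintegral_swap (by fun_prop)
    _ = ∫⁻ t, ∫⁻ u, betaPDF a b u * gammaPDF (a + b) r t * F (u, t) := by
        refine lintegral_congr_ae ?_
        filter_upwards [volume.ae_ne 0] with t ht
        rcases ht.lt_or_gt with ht | ht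
        · have hx : ∀ x, gammaPDF a r x * gammaPDF b r (t - x) = 0 := fun x => by
            rcases lt_or_ge x 0 with h | h
            · rw [gammaPDF_of_neg h, zero_mul]
            · rw [gammaPDF_of_neg (sub_neg.2 (ht.trans_le h)), mul_zero]
          simp [hx, gammaPDF_of_neg ht]
        rw [lintegral_comp_mul_left ht (by fun_prop)]
        refine lintegral_congr_ae ?_
        filter_upwards [volume.ae_ne 0, volume.ae_ne 1] with u hu0 hu1
        rw [← gammaPDF_mul_gammaPDF ha hb hr ht hu0 hu1, mul_div_cancel_left₀ _ ht.ne', mul_assoc]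
        ring

lemma map_div_add_gammaMeasure (ha : 0 < a) (hb : 0 < b) (hr : 0 < r) :
    ((gammaMeasure a r).prod (gammaMeasure b r)).map (fun x => x.1 / (x.1 + x.2))
      = betaMeasure a b := by
  have := isProbabilityMeasure_gammaMeasure (add_pos ha hb) hr
  simpa [Measure.map_map measurable_fst (by fun_prop : Measurable fun x : ℝ × ℝ =>
    (x.1 / (x.1 + x.2), x.1 + x.2)), Measure.map_fst_prod, Function.comp_def]
    using congrArg (Measure.map Prod.fst) (map_prodMk_div_add_gammaMeasure ha hb hr)

lemma map_sum_pi_gammaMeasure {ι : Type*} [Fintype ι] {α : ι → ℝ} (hα : ∀ i, 0 < α i) (hr : 0 < r)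
    {B : Finset ι} (hB : B.Nonempty) :
    (Measure.pi fun i => gammaMeasure (α i) r).map (fun g => ∑ i ∈ B, g i)
      = gammaMeasure (∑ i ∈ B, α i) r := by
  have hp := fun i => isProbabilityMeasure_gammaMeasure (hα i) hr
  have hs : 0 < ∑ i ∈ B, α i := Finset.sum_pos (fun i _ => hα i) hB
  have := isProbabilityMeasure_gammaMeasure hs hr
  have hind : iIndepFun (fun i (g : ι → ℝ) => g i) (Measure.pi fun i => gammaMeasure (α i) r) :=
    iIndepFun_pi (X := fun _ => id) fun _ => aemeasurable_id
  refine Measure.ext_of_charFun ?_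
  rw [(hind.restrict B).charFun_map_fun_finsetSum_eq_prod
    fun i _ => (measurable_pi_apply i).aemeasurable]
  ext t
  have hz : (1 - t * Complex.I / r : ℂ) ≠ 0 := fun h => by
    simpa [Complex.div_ofReal_re] using congrArg Complex.re h
  simp_rw [Finset.prod_apply, (measurePreserving_eval _ _).map_eq, charFun_gammaMeasure (hα _) hr,
    charFun_gammaMeasure hs hr, Complex.cpow_def_of_ne_zero hz, ← Complex.exp_sum,
    ← Finset.mul_sum]
  push_cast
  rw [Finset.sum_neg_distrib]

lemma map_sum_sum_compl_pi_gammaMeasure {ι : Type*} [Fintype ι] [DecidableEq ι] {α : ι → ℝ}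
    (hα : ∀ i, 0 < α i) (hr : 0 < r) {B : Finset ι} (hB : B.Nonempty) (hB' : Bᶜ.Nonempty) :
    (Measure.pi fun i => gammaMeasure (α i) r).map (fun g => (∑ i ∈ B, g i, ∑ i ∈ Bᶜ, g i))
      = (gammaMeasure (∑ i ∈ B, α i) r).prod (gammaMeasure (∑ i ∈ Bᶜ, α i) r) := by
  have hp := fun i => isProbabilityMeasure_gammaMeasure (hα i) hr
  have hind : iIndepFun (fun i (g : ι → ℝ) => g i) (Measure.pi fun i => gammaMeasure (α i) r) :=
    iIndepFun_pi (X := fun _ => id) fun _ => aemeasurable_id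
  have hBB' := (hind.indepFun_finset B Bᶜ disjoint_compl_right (by fun_prop)).comp
    (φ := fun x => ∑ i, x i) (ψ := fun x => ∑ i, x i) (by fun_prop) (by fun_prop)
  have hcoe : ∀ C : Finset ι, (fun x : C → ℝ => ∑ i, x i) ∘ (fun g i => g i.1)
      = fun g : ι → ℝ => ∑ i ∈ C, g i := fun C => funext fun g => Finset.sum_coe_sort C g
  rw [hcoe, hcoe] at hBB'
  rw [(indepFun_iff_map_prod_eq_prod_map_map (by fun_prop) (by fun_prop)).1 hBB',
    map_sum_pi_gammaMeasure hα hr hB, map_sum_pi_gammaMeasure hα hr hB']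

end GammaBeta

section BetaMoments

variable {a b : ℝ}

lemma measurable_betaPDF (a b : ℝ) : Measurable (betaPDF a b) :=
  (measurable_betaPDFReal a b).ennreal_ofReal

lemma integral_betaMeasure (ha : 0 < a) (hb : 0 < b) (f : ℝ → ℝ) :
    ∫ x, f x ∂betaMeasure a b = ∫ x, betaPDFReal a b x * f x := by
  rw [betaMeasure, integral_withDensity_eq_integral_toReal_smul (measurable_betaPDF a b)
    (ae_of_all _ fun _ => ENNReal.ofReal_lt_top)]
  refine integral_congr_ae (ae_of_all _ fun x => ?_)
  have : 0 ≤ betaPDFReal a b x := by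
    have := beta_pos ha hb
    rw [betaPDFReal]
    split_ifs with h
    · have := sub_pos.2 h.2
      have := h.1
      positivity
    · rfl
  simp only [betaPDF, ENNReal.toReal_ofReal this, smul_eq_mul]

lemma betaPDFReal_mul_self (ha : 0 < a) (hb : 0 < b) (x : ℝ) :
    betaPDFReal a b x * x = a / (a + b) * betaPDFReal (a + 1) b x := by
  simp only [betaPDFReal]
  split_ifs with h
  · have hG := (Real.Gamma_pos_of_pos ha).ne'
    have hGb := (Real.Gamma_pos_of_pos hb).ne'
    have hGab := (Real.Gamma_pos_of_pos (add_pos ha hb)).ne'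
    have hab := (add_pos ha hb).ne'
    rw [show a + 1 - 1 = a - 1 + 1 by ring, Real.rpow_add_one h.1.ne', beta, beta,
      show a + 1 + b = a + b + 1 by ring, Real.Gamma_add_one ha.ne', Real.Gamma_add_one hab]
    field_simp
  · simp

lemma integral_id_mul_betaMeasure (ha : 0 < a) (hb : 0 < b) (f : ℝ → ℝ) :
    ∫ x, x * f x ∂betaMeasure a b = a / (a + b) * ∫ x, f x ∂betaMeasure (a + 1) b := by
  rw [integral_betaMeasure ha hb, integral_betaMeasure (by positivity) hb, ← integral_const_mul]
  simp only [← mul_assoc, betaPDFReal_mul_self ha hb]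

lemma integral_id_betaMeasure (ha : 0 < a) (hb : 0 < b) :
    ∫ x, x ∂betaMeasure a b = a / (a + b) := by
  have := isProbabilityMeasureBeta (add_pos ha one_pos) hb
  simpa using integral_id_mul_betaMeasure ha hb fun _ => 1

lemma integral_sq_betaMeasure (ha : 0 < a) (hb : 0 < b) :
    ∫ x, x ^ 2 ∂betaMeasure a b = a / (a + b) * ((a + 1) / (a + 1 + b)) := by
  simp only [sq]
  rw [integral_id_mul_betaMeasure ha hb, integral_id_betaMeasure (by positivity) hb]

lemma ae_mem_Ioo_betaMeasure (a b : ℝ) : ∀ᵐ x ∂betaMeasure a b, x ∈ Set.Ioo (0 : ℝ) 1 := by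
  rw [betaMeasure, ae_withDensity_iff (measurable_betaPDF a b)]
  refine ae_of_all _ fun x hx => ⟨not_le.1 fun h => hx (betaPDF_eq_zero_of_nonpos h),
    not_le.1 fun h => hx (betaPDF_eq_zero_of_one_le h)⟩

lemma memLp_id_betaMeasure (ha : 0 < a) (hb : 0 < b) (p : ENNReal) :
    MemLp id p (betaMeasure a b) := by
  have := isProbabilityMeasureBeta ha hb
  refine .of_bound aestronglyMeasurable_id 1 ?_
  filter_upwards [ae_mem_Ioo_betaMeasure a b] with x hx
  rw [id, Real.norm_eq_abs, abs_of_pos hx.1]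
  exact hx.2.le

lemma variance_id_betaMeasure (ha : 0 < a) (hb : 0 < b) :
    variance id (betaMeasure a b) = a / (a + b) * (1 - a / (a + b)) / (a + b + 1) := by
  have := isProbabilityMeasureBeta ha hb
  rw [variance_eq_sub (memLp_id_betaMeasure ha hb 2)]
  simp only [Pi.pow_apply, id]
  rw [integral_sq_betaMeasure ha hb, integral_id_betaMeasure ha hb]
  have : a + 1 + b ≠ 0 := by positivity
  field_simp
  ring

end BetaMoments

section Dirichlet

lemma variance_fun_const {Ω : Type*} [MeasurableSpace Ω] (μ : Measure Ω) [IsProbabilityMeasure μ]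
    (c : ℝ) : variance (fun _ => c) μ = 0 := by
  rw [← covariance_self aemeasurable_const, covariance_const_left]

variable {n : ℕ} {α : Fin n → ℝ}

lemma isProbabilityMeasure_dirichlet (hα : ∀ i, 0 < α i) : IsProbabilityMeasure (dirichlet α) := by
  have hp := fun i => isProbabilityMeasure_gammaMeasure (hα i) one_pos
  exact Measure.isProbabilityMeasure_map (by fun_prop)

lemma ae_mem_stdSimplex_dirichlet [NeZero n] (hα : ∀ i, 0 < α i) :
    ∀ᵐ v ∂dirichlet α, v ∈ stdSimplex ℝ (Fin n) := by
  have hp := fun i => isProbabilityMeasure_gammaMeasure (hα i) one_pos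
  refine (ae_map_iff (by fun_prop) (isClosed_stdSimplex ℝ (Fin n)).measurableSet).2 ?_
  have hpos : ∀ᵐ g ∂Measure.pi fun i => gammaMeasure (α i) 1, ∀ i, 0 < g i :=
    ae_all_iff.2 fun i =>
      (Measure.quasiMeasurePreserving_eval _ i).ae (ae_pos_gammaMeasure (α i) 1)
  filter_upwards [hpos] with g hg
  have hs : 0 < ∑ j, g j := Finset.sum_pos (fun i _ => hg i) Finset.univ_nonempty
  exact ⟨fun i => (div_pos (hg i) hs).le, by rw [← Finset.sum_div, div_self hs.ne']⟩

lemma map_sum_dirichlet (hα : ∀ i, 0 < α i) {B : Finset (Fin n)} (hB : B.Nonempty)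
    (hB' : Bᶜ.Nonempty) :
    (dirichlet α).map (fun v => ∑ i ∈ B, v i) = betaMeasure (∑ i ∈ B, α i) (∑ i ∈ Bᶜ, α i) := by
  have hs {B : Finset (Fin n)} := Finset.sum_pos (s := B) fun i _ => hα i
  rw [dirichlet, ← map_div_add_gammaMeasure (hs hB) (hs hB') one_pos,
    ← map_sum_sum_compl_pi_gammaMeasure hα one_pos hB hB', Measure.map_map (by fun_prop)
    (by fun_prop), Measure.map_map (by fun_prop) (by fun_prop)]
  simp only [Function.comp_def, ← Finset.sum_div, Finset.sum_add_sum_compl]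

lemma sum_ae_eq_one_dirichlet [NeZero n] (hα : ∀ i, 0 < α i) :
    (fun v => ∑ i, v i) =ᵐ[dirichlet α] fun _ => 1 := by
  filter_upwards [ae_mem_stdSimplex_dirichlet hα] with v hv using hv.2

lemma integral_sum_dirichlet [NeZero n] (hα : ∀ i, 0 < α i) (B : Finset (Fin n)) :
    ∫ v, ∑ i ∈ B, v i ∂dirichlet α = (∑ i ∈ B, α i) / ∑ i, α i := by
  have := isProbabilityMeasure_dirichlet hα
  have hs {B : Finset (Fin n)} := Finset.sum_pos (s := B) fun i _ => hα i
  rcases B.eq_empty_or_nonempty with rfl | hB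
  · simp
  rcases (Bᶜ).eq_empty_or_nonempty with hB' | hB'
  · obtain rfl := (Finset.compl_eq_empty_iff B).1 hB'
    rw [integral_congr_ae (sum_ae_eq_one_dirichlet hα), div_self (hs hB).ne']
    simp
  · rw [← Finset.sum_add_sum_compl B, ← integral_id_betaMeasure (hs hB)
      (hs hB'), ← map_sum_dirichlet hα hB hB', integral_map (by fun_prop)
      (by fun_prop)]

lemma variance_sum_dirichlet [NeZero n] (hα : ∀ i, 0 < α i) (B : Finset (Fin n)) :
    variance (fun v => ∑ i ∈ B, v i) (dirichlet α)
      = (∑ i ∈ B, α i) / (∑ i, α i) * (1 - (∑ i ∈ B, α i) / ∑ i, α i) / (∑ i, α i + 1) := by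
  have := isProbabilityMeasure_dirichlet hα
  have hs {B : Finset (Fin n)} := Finset.sum_pos (s := B) fun i _ => hα i
  rcases B.eq_empty_or_nonempty with rfl | hB
  · simp [variance_fun_const]
  rcases (Bᶜ).eq_empty_or_nonempty with hB' | hB'
  · obtain rfl := (Finset.compl_eq_empty_iff B).1 hB'
    rw [variance_congr (sum_ae_eq_one_dirichlet hα), div_self (hs hB).ne']
    simp [variance_fun_const]
  · rw [← Finset.sum_add_sum_compl B, ← variance_id_betaMeasure (hs hB)
      (hs hB'), ← map_sum_dirichlet hα hB hB', variance_map (by fun_prop)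
      (by fun_prop)]
    rfl

lemma memLp_sum_dirichlet [NeZero n] (hα : ∀ i, 0 < α i) (B : Finset (Fin n)) (p : ENNReal) :
    MemLp (fun v => ∑ i ∈ B, v i) p (dirichlet α) := by
  have := isProbabilityMeasure_dirichlet hα
  refine .of_bound (by fun_prop) 1 ?_
  filter_upwards [ae_mem_stdSimplex_dirichlet hα] with v hv
  rw [Real.norm_eq_abs, abs_of_nonneg (Finset.sum_nonneg fun i _ => hv.1 i), ← hv.2]
  exact Finset.sum_le_univ_sum_of_nonneg hv.1

end Dirichlet

section Gaussian

lemma tendsto_real_of_tendsto_charFun {μ : ℕ → Measure ℝ} [∀ k, IsProbabilityMeasure (μ k)]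
    {ν : Measure ℝ} [IsProbabilityMeasure ν]
    (h : ∀ t, Tendsto (fun k => charFun (μ k) t) atTop (𝓝 (charFun ν t))) {E : Set ℝ}
    (hE : ν (frontier E) = 0) :
    Tendsto (fun k => (μ k).real E) atTop (𝓝 (ν.real E)) := by
  have hl := ProbabilityMeasure.tendsto_of_tendsto_charFun (μ := fun k => ⟨μ k, inferInstance⟩)
    (μ₀ := ⟨ν, inferInstance⟩) h
  exact (ENNReal.tendsto_toReal (measure_ne_top _ _)).comp
    (ProbabilityMeasure.tendsto_measure_of_null_frontier_of_tendsto' hl hE)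

lemma gaussianReal_frontier_Ici {v : NNReal} (hv : v ≠ 0) (m x : ℝ) :
    gaussianReal m v (frontier (Set.Ici x)) = 0 := by
  have := nullSingletonClass_gaussianReal (μ := m) hv
  simp

lemma gaussianReal_real_Ici (x : ℝ) {s : ℝ} (hs : 0 < s) {v : ℝ} (hv : 0 ≤ v) :
    (gaussianReal (s * x) v.toNNReal).real (Set.Ici 0)
      = (gaussianReal 0 (v / s ^ 2).toNNReal).real (Set.Iic x) := by
  have h : gaussianReal (s * x) v.toNNReal
      = (gaussianReal 0 (v / s ^ 2).toNNReal).map (fun y => s * x + -s * y) := by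
    have hc : (fun y => s * x + -s * y) = (fun y => s * x + y) ∘ fun y => -s * y := rfl
    rw [hc, ← Measure.map_map (by fun_prop) (by fun_prop), gaussianReal_map_const_mul,
      gaussianReal_map_const_add]
    congr 1
    · simp
    · ext
      simp only [NNReal.coe_mul, NNReal.coe_mk]
      rw [Real.coe_toNNReal _ hv, Real.coe_toNNReal _ (by positivity)]
      field_simp
  rw [h, map_measureReal_apply (by fun_prop) measurableSet_Ici]
  congr 1
  ext y
  rw [Set.mem_preimage, Set.mem_Ici, Set.mem_Iic, neg_mul, ← sub_eq_add_neg, sub_nonneg,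
    mul_le_mul_iff_right₀ hs]

end Gaussian

section BetaClt

variable {ι : Type*} {l : Filter ι} {c p : ι → ℝ} {q τ : ℝ}

lemma log_one_add_isLittleO :
    (fun z => Complex.log (1 + z) - (z - z ^ 2 / 2)) =o[𝓝 0] fun z : ℂ => z ^ 2 := by
  refine ((Complex.log_sub_logTaylor_isBigO 2).congr_left fun z => ?_).trans_isLittleO
    (Asymptotics.isLittleO_pow_pow (by norm_num))
  simp [Complex.logTaylor, Finset.sum_range_succ]
  ring

lemma tendsto_mul_log_one_add_div_sqrt (hc : Tendsto c l atTop) (z : ℂ) :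
    Tendsto (fun k => c k * Complex.log (1 + z / √(c k)) - (√(c k) * z - z ^ 2 / 2)) l (𝓝 0) := by
  have hs : Tendsto (fun k => z / (√(c k) : ℂ)) l (𝓝 0) := by
    refine tendsto_zero_iff_norm_tendsto_zero.2 ?_
    simpa [abs_of_nonneg (Real.sqrt_nonneg _)] using
      (Real.tendsto_sqrt_atTop.comp hc).const_div_atTop ‖z‖
  have ho := (Asymptotics.isBigO_refl (fun k => (c k : ℂ)) l).mul_isLittleO
    (log_one_add_isLittleO.comp_tendsto hs)
  have hbdd : (fun k => (c k : ℂ) * (z / √(c k)) ^ 2) =O[l] fun _ => (1 : ℝ) := by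
    refine .of_bound (‖z‖ ^ 2) ?_
    filter_upwards [hc.eventually_gt_atTop 0] with k hk
    have hsq : (√(c k) : ℂ) ^ 2 = c k := by rw [← Complex.ofReal_pow, Real.sq_sqrt hk.le]
    rw [div_pow, hsq, mul_div_cancel₀ _ (Complex.ofReal_ne_zero.2 hk.ne')]
    simp
  refine ((Asymptotics.isLittleO_one_iff ℝ).1 (ho.trans_isBigO hbdd)).congr' ?_
  filter_upwards [hc.eventually_gt_atTop 0] with k hk
  have hsq : (√(c k) : ℂ) ^ 2 = c k := by rw [← Complex.ofReal_pow, Real.sq_sqrt hk.le]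
  have hne : (√(c k) : ℂ) ≠ 0 := Complex.ofReal_ne_zero.2 (Real.sqrt_pos.2 hk).ne'
  simp only [Function.comp_apply]
  generalize Complex.log (1 + z / √(c k)) = L
  rw [← hsq]
  field_simp

lemma tendsto_of_tendsto_sqrt_mul_sub (hc : Tendsto c l atTop)
    (hp : Tendsto (fun k => √(c k) * (p k - q)) l (𝓝 τ)) : Tendsto p l (𝓝 q) := by
  have h := (hp.div_atTop (Real.tendsto_sqrt_atTop.comp hc)).add_const q
  rw [zero_add] at h
  refine h.congr' ?_
  filter_upwards [hc.eventually_gt_atTop 0] with k hk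
  simp [mul_div_cancel_left₀ _ (Real.sqrt_pos.2 hk).ne']

-- The level `q` splits the increments as `1 - q` and `-q`; the terms of order `√c` combine to
-- `√c * (p - q) * t`, those of order one to the variance `q * (1 - q)`.
lemma tendsto_log_charFun_gamma_sub_gamma (hc : Tendsto c l atTop)
    (hp : Tendsto (fun k => √(c k) * (p k - q)) l (𝓝 τ)) (t : ℝ) :
    Tendsto (fun k =>
        -(p k * (c k * Complex.log (1 + -(1 - q) * t * Complex.I / √(c k))))
          - (1 - p k) * (c k * Complex.log (1 + q * t * Complex.I / √(c k)))) l
      (𝓝 (t * τ * Complex.I - q * (1 - q) * t ^ 2 / 2)) := by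
  have hpC : Tendsto (fun k => (p k : ℂ)) l (𝓝 (q : ℂ)) :=
    (Complex.continuous_ofReal.tendsto _).comp (tendsto_of_tendsto_sqrt_mul_sub hc hp)
  have hd : Tendsto (fun k => ((√(c k) * (p k - q) : ℝ) : ℂ)) l (𝓝 (τ : ℂ)) :=
    (Complex.continuous_ofReal.tendsto _).comp hp
  have h1 := hpC.mul (tendsto_mul_log_one_add_div_sqrt hc (-(1 - q) * t * Complex.I))
  have h2 := (hpC.const_sub 1).mul (tendsto_mul_log_one_add_div_sqrt hc (q * t * Complex.I))
  have h3 := (hpC.mul_const ((1 - q) ^ 2 * t ^ 2 / 2 : ℂ)).add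
    ((hpC.const_sub 1).mul_const (q ^ 2 * t ^ 2 / 2 : ℂ))
  convert ((hd.mul_const (t * Complex.I)).sub h3).sub (h1.add h2) using 2 with k
  · push_cast
    ring_nf
    simp only [Complex.I_sq]
    ring
  · ring

lemma charFun_map_prod_gammaMeasure {a b : ℝ} (ha : 0 < a) (hb : 0 < b) (u v t : ℝ) :
    charFun (((gammaMeasure a 1).prod (gammaMeasure b 1)).map fun x => u * x.1 + v * x.2) t
      = (1 - u * t * Complex.I) ^ (-a : ℂ) * (1 - v * t * Complex.I) ^ (-b : ℂ) := by
  have := isProbabilityMeasure_gammaMeasure ha one_pos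
  have := isProbabilityMeasure_gammaMeasure hb one_pos
  have h : ((gammaMeasure a 1).prod (gammaMeasure b 1)).map (fun x => u * x.1 + v * x.2)
      = (((gammaMeasure a 1).map (u * ·)).prod ((gammaMeasure b 1).map (v * ·))).map
          (fun x => x.1 + x.2) := by
    rw [Measure.map_prod_map _ _ (by fun_prop) (by fun_prop),
      Measure.map_map (by fun_prop) (by fun_prop)]
    rfl
  have : IsProbabilityMeasure ((gammaMeasure a 1).map (u * ·)) :=
    Measure.isProbabilityMeasure_map (by fun_prop)
  have : IsProbabilityMeasure ((gammaMeasure b 1).map (v * ·)) :=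
    Measure.isProbabilityMeasure_map (by fun_prop)
  rw [h, charFun_map_add_prod_eq_mul, Pi.mul_apply, charFun_map_mul, charFun_map_mul,
    charFun_gammaMeasure ha one_pos, charFun_gammaMeasure hb one_pos]
  simp

lemma betaMeasure_real_Ici {a b s : ℝ} (ha : 0 < a) (hb : 0 < b) (q : ℝ) (hs : 0 < s) :
    (betaMeasure a b).real (Set.Ici q)
      = (((gammaMeasure a 1).prod (gammaMeasure b 1)).map
          fun x => (1 - q) / s * x.1 + -q / s * x.2).real (Set.Ici 0) := by
  have := isProbabilityMeasure_gammaMeasure ha one_pos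
  have := isProbabilityMeasure_gammaMeasure hb one_pos
  rw [← map_div_add_gammaMeasure ha hb one_pos,
    map_measureReal_apply (by fun_prop) measurableSet_Ici,
    map_measureReal_apply (by fun_prop) measurableSet_Ici]
  refine measureReal_congr ?_
  filter_upwards [Measure.quasiMeasurePreserving_fst.ae (ae_pos_gammaMeasure a 1),
    Measure.quasiMeasurePreserving_snd.ae (ae_pos_gammaMeasure b 1)] with x hx hy
  refine propext ?_
  change q ≤ x.1 / (x.1 + x.2) ↔ 0 ≤ (1 - q) / s * x.1 + -q / s * x.2
  have e : (1 - q) / s * x.1 + -q / s * x.2 = (x.1 - q * (x.1 + x.2)) / s := by ring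
  rw [e, le_div_iff₀ (add_pos hx hy), le_div_iff₀ hs, zero_mul, sub_nonneg]

lemma tendsto_betaMeasure_real_Ici_atTop (hq0 : 0 < q) (hq1 : q < 1) {c p : ℕ → ℝ}
    (hc0 : ∀ k, 0 < c k) (hc : Tendsto c atTop atTop) (hp01 : ∀ k, p k ∈ Set.Ioo (0 : ℝ) 1)
    (hp : Tendsto (fun k => √(c k) * (p k - q)) atTop (𝓝 τ)) :
    Tendsto (fun k => (betaMeasure (c k * p k) (c k * (1 - p k))).real (Set.Ici q)) atTop
      (𝓝 ((gaussianReal τ (q * (1 - q)).toNNReal).real (Set.Ici 0))) := by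
  have ha : ∀ k, 0 < c k * p k := fun k => mul_pos (hc0 k) (hp01 k).1
  have hb : ∀ k, 0 < c k * (1 - p k) := fun k => mul_pos (hc0 k) (sub_pos.2 (hp01 k).2)
  have hv : 0 < q * (1 - q) := mul_pos hq0 (sub_pos.2 hq1)
  have hA := fun k => isProbabilityMeasure_gammaMeasure (ha k) one_pos
  have hB := fun k => isProbabilityMeasure_gammaMeasure (hb k) one_pos
  have hμ : ∀ k, IsProbabilityMeasure (((gammaMeasure (c k * p k) 1).prod
      (gammaMeasure (c k * (1 - p k)) 1)).map
        fun x => (1 - q) / √(c k) * x.1 + -q / √(c k) * x.2) := fun k =>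
    Measure.isProbabilityMeasure_map (by fun_prop)
  simp only [fun k => betaMeasure_real_Ici (ha k) (hb k) q (Real.sqrt_pos.2 (hc0 k))]
  refine tendsto_real_of_tendsto_charFun (fun t => ?_) (gaussianReal_frontier_Ici (by simpa) τ 0)
  have hlim := (Complex.continuous_exp.tendsto _).comp
    (tendsto_log_charFun_gamma_sub_gamma hc hp t)
  rw [charFun_gaussianReal, Real.coe_toNNReal _ hv.le]
  convert hlim using 2 with k
  · have hne : ∀ u : ℝ, (1 - u * Complex.I : ℂ) ≠ 0 := fun u h => by
      simpa using congrArg Complex.re h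
    rw [charFun_map_prod_gammaMeasure (ha k) (hb k), ← Complex.ofReal_mul, ← Complex.ofReal_mul,
      Complex.cpow_def_of_ne_zero (hne _), Complex.cpow_def_of_ne_zero (hne _), ← Complex.exp_add]
    push_cast
    simp only [Function.comp_apply]
    ring_nf
  · push_cast
    ring_nf

lemma tendsto_betaMeasure_real_Ici_of_isCountablyGenerated [l.IsCountablyGenerated]
    (hq0 : 0 < q) (hq1 : q < 1) (hc : Tendsto c l atTop)
    (hp : Tendsto (fun k => √(c k) * (p k - q)) l (𝓝 τ)) :
    Tendsto (fun k => (betaMeasure (c k * p k) (c k * (1 - p k))).real (Set.Ici q)) l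
      (𝓝 ((gaussianReal τ (q * (1 - q)).toNNReal).real (Set.Ici 0))) := by
  refine tendsto_of_seq_tendsto fun x hx => ?_
  have hgood : ∀ᶠ n in atTop, 0 < c (x n) ∧ p (x n) ∈ Set.Ioo (0 : ℝ) 1 :=
    hx.eventually ((hc.eventually_gt_atTop 0).and
      ((tendsto_of_tendsto_sqrt_mul_sub hc hp).eventually (Ioo_mem_nhds hq0 hq1)))
  obtain ⟨N, hN⟩ := eventually_atTop.1 hgood
  have hshift := hx.comp (tendsto_add_atTop_nat N)
  exact (tendsto_add_atTop_iff_nat N).1 <| tendsto_betaMeasure_real_Ici_atTop hq0 hq1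
    (fun n => (hN _ (N.le_add_left n)).1) (hc.comp hshift)
    (fun n => (hN _ (N.le_add_left n)).2) (hp.comp hshift)

lemma tendsto_betaMeasure_real_Ici (hq0 : 0 < q) (hq1 : q < 1)
    (hc : Tendsto c l atTop) (hp : Tendsto (fun k => √(c k) * (p k - q)) l (𝓝 τ)) :
    Tendsto (fun k => (betaMeasure (c k * p k) (c k * (1 - p k))).real (Set.Ici q)) l
      (𝓝 ((gaussianReal τ (q * (1 - q)).toNNReal).real (Set.Ici 0))) := by
  -- Pulled back to the pairs `(c, p)`, the two hypotheses define a countably generated filter.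
  let L : Filter (ℝ × ℝ) := comap Prod.fst atTop ⊓ comap (fun x => √x.1 * (x.2 - q)) (𝓝 τ)
  have hL : Tendsto (fun k => (c k, p k)) l L :=
    tendsto_inf.2 ⟨tendsto_comap_iff.2 hc, tendsto_comap_iff.2 hp⟩
  have h := (tendsto_betaMeasure_real_Ici_of_isCountablyGenerated (l := L) hq0 hq1
    (tendsto_comap.mono_left inf_le_left) (tendsto_comap.mono_left inf_le_right)).comp hL
  simpa only [Function.comp_def] using h

end BetaClt

section Anticoncentration

lemma rpow_mul_exp_neg_le {a x : ℝ} (ha : 0 < a) (hx : 0 < x) :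
    x ^ a * Real.exp (-x) ≤ a ^ a * Real.exp (-a) := by
  rw [Real.rpow_def_of_pos hx, Real.rpow_def_of_pos ha, ← Real.exp_add, ← Real.exp_add,
    Real.exp_le_exp]
  have hlog := Real.log_le_sub_one_of_pos (div_pos hx ha)
  rw [Real.log_div hx.ne' ha.ne'] at hlog
  have hmul := mul_le_mul_of_nonneg_left hlog ha.le
  rw [mul_sub_one, mul_div_cancel₀ x ha.ne'] at hmul
  linarith

lemma rpow_mul_exp_neg_ge {a x : ℝ} (ha : 0 < a) (hx : a ≤ x) (hx' : x ≤ a + √a) :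
    a ^ a * Real.exp (-a) * Real.exp (-(1 / 2)) ≤ x ^ a * Real.exp (-x) := by
  rw [Real.rpow_def_of_pos (ha.trans_le hx), Real.rpow_def_of_pos ha, ← Real.exp_add,
    ← Real.exp_add, ← Real.exp_add, Real.exp_le_exp]
  obtain ⟨u, hu, rfl⟩ : ∃ u, 0 ≤ u ∧ x = a * (1 + u) :=
    ⟨x / a - 1, by rw [sub_nonneg, le_div_iff₀ ha]; linarith, by field_simp; ring⟩
  have hlog : u - u ^ 2 / 2 ≤ Real.log (1 + u) := by
    refine le_trans ?_ (Real.le_log_one_add_of_nonneg hu)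
    rw [le_div_iff₀ (by linarith)]
    nlinarith [pow_nonneg hu 3]
  have hau : a * u ^ 2 ≤ 1 := by
    have h : (a * u) ^ 2 ≤ √a ^ 2 := pow_le_pow_left₀ (by positivity) (by linarith) 2
    rw [Real.sq_sqrt ha.le] at h
    exact le_of_mul_le_mul_left (by linarith) ha
  rw [Real.log_mul ha.ne' (by linarith)]
  nlinarith

lemma sqrt_mul_rpow_mul_exp_neg_le_Gamma_add_one {a : ℝ} (ha : 0 < a) :
    √a * (a ^ a * Real.exp (-a) * Real.exp (-(1 / 2))) ≤ Real.Gamma (a + 1) := by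
  have hint : IntegrableOn (fun x => Real.exp (-x) * x ^ (a + 1 - 1)) (Set.Ioi 0) :=
    Real.GammaIntegral_convergent (by positivity)
  rw [Real.Gamma_eq_integral (by positivity)]
  calc √a * (a ^ a * Real.exp (-a) * Real.exp (-(1 / 2)))
      = ∫ _ in Set.Ioc a (a + √a), (a ^ a * Real.exp (-a) * Real.exp (-(1 / 2))) := by
        rw [setIntegral_const, Real.volume_real_Ioc_of_le (by simp), add_sub_cancel_left,
          smul_eq_mul]
    _ ≤ ∫ x in Set.Ioc a (a + √a), Real.exp (-x) * x ^ (a + 1 - 1) := by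
        refine setIntegral_mono_on continuous_const.integrableOn_Ioc
          (hint.mono_set fun y hy => ha.trans hy.1) measurableSet_Ioc fun y hy => ?_
        rw [add_sub_cancel_right, mul_comm (Real.exp (-y))]
        exact rpow_mul_exp_neg_ge ha hy.1.le hy.2
    _ ≤ ∫ x in Set.Ioi 0, Real.exp (-x) * x ^ (a + 1 - 1) := by
        refine setIntegral_mono_set hint ?_ (ae_of_all _ fun y hy => ha.trans hy.1)
        filter_upwards [ae_restrict_mem measurableSet_Ioi] with y (hy : 0 < y)
        simp only [Pi.zero_apply]
        positivity

lemma rpow_mul_exp_neg_le_Gamma {a x : ℝ} (ha : 0 < a) (hx : 0 < x) :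
    x ^ a * Real.exp (-x) ≤ √a * Real.exp (1 / 2) * Real.Gamma a := by
  have hsa := Real.sqrt_pos.2 ha
  have hstirling : √a * (a ^ a * Real.exp (-a) * Real.exp (-(1 / 2)))
      ≤ √a * (√a * Real.Gamma a) := by
    rw [← mul_assoc (√a) (√a), Real.mul_self_sqrt ha.le, ← Real.Gamma_add_one ha.ne']
    exact sqrt_mul_rpow_mul_exp_neg_le_Gamma_add_one ha
  calc x ^ a * Real.exp (-x) ≤ a ^ a * Real.exp (-a) := rpow_mul_exp_neg_le ha hx
    _ = a ^ a * Real.exp (-a) * Real.exp (-(1 / 2)) * Real.exp (1 / 2) := by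
        rw [mul_assoc _ (Real.exp (-(1 / 2))), ← Real.exp_add]; simp
    _ ≤ √a * Real.Gamma a * Real.exp (1 / 2) := by
        have h := le_of_mul_le_mul_left hstirling hsa
        exact mul_le_mul_of_nonneg_right h (Real.exp_nonneg _)
    _ = _ := by ring

lemma gammaMeasure_Ico_le {a s t : ℝ} (ha : 0 < a) (hs : 0 < s) :
    gammaMeasure a 1 (Set.Ico s t) ≤ ENNReal.ofReal (√a * Real.exp (1 / 2) * (t / s - 1)) := by
  have hG := Real.Gamma_pos_of_pos ha
  rw [gammaMeasure, withDensity_apply _ measurableSet_Ico]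
  calc ∫⁻ x in Set.Ico s t, gammaPDF a 1 x
      ≤ ∫⁻ _ in Set.Ico s t, ENNReal.ofReal (√a * Real.exp (1 / 2) / s) := by
        refine setLIntegral_mono (by fun_prop) fun x hx => ?_
        have hx0 : 0 < x := hs.trans_le hx.1
        rw [gammaPDF_of_nonneg hx0.le]
        refine ENNReal.ofReal_le_ofReal ?_
        have hpdf : (1 : ℝ) ^ a / Real.Gamma a * x ^ (a - 1) * Real.exp (-(1 * x))
            = x ^ a * Real.exp (-x) / Real.Gamma a / x := by
          rw [Real.rpow_sub_one hx0.ne', Real.one_rpow, one_mul]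
          field_simp
        rw [hpdf]
        have hmode := (div_le_iff₀ hG).2 (rpow_mul_exp_neg_le_Gamma ha hx0)
        gcongr
        exact hx.1
    _ = ENNReal.ofReal (√a * Real.exp (1 / 2) * (t / s - 1)) := by
        rw [setLIntegral_const, Real.volume_Ico, ← ENNReal.ofReal_mul (by positivity)]
        congr 1
        field_simp

-- Conditionally on the second gamma variable `y`, the ratio `x / (x + y)` lies in `[q - η, q)` when
-- `x` lies in an interval whose endpoints have a ratio that does not depend on `y`.
lemma betaMeasure_real_Ico_le {a b q η : ℝ} (ha : 0 < a) (hb : 0 < b) (hη : 0 ≤ η) (hηq : η < q)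
    (hq1 : q < 1) :
    (betaMeasure a b).real (Set.Ico (q - η) q)
      ≤ √a * Real.exp (1 / 2) * (η / ((1 - q) * (q - η))) := by
  have h1q : 0 < 1 - q := sub_pos.2 hq1
  have hqη : 0 < q - η := sub_pos.2 hηq
  have h1qη : 0 < 1 - q + η := by linarith
  have hpa := isProbabilityMeasure_gammaMeasure ha one_pos
  have hpb := isProbabilityMeasure_gammaMeasure hb one_pos
  have hslice (y : ℝ) (hy : 0 < y) :
      gammaMeasure a 1 {x | x / (x + y) ∈ Set.Ico (q - η) q}
        ≤ ENNReal.ofReal (√a * Real.exp (1 / 2) * (η / ((1 - q) * (q - η)))) := by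
    have hs : 0 < (q - η) / (1 - q + η) * y := by positivity
    have hsub : {x | x / (x + y) ∈ Set.Ico (q - η) q} ≤ᵐ[gammaMeasure a 1]
        Set.Ico ((q - η) / (1 - q + η) * y) (q / (1 - q) * y) := by
      filter_upwards [ae_pos_gammaMeasure a 1] with x hx ⟨hle, hlt⟩
      rw [le_div_iff₀ (add_pos hx hy)] at hle
      rw [div_lt_iff₀ (add_pos hx hy)] at hlt
      constructor
      · rw [div_mul_eq_mul_div, div_le_iff₀ h1qη]; linarith
      · rw [div_mul_eq_mul_div, lt_div_iff₀ h1q]; linarith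
    refine ((measure_mono_ae hsub).trans (gammaMeasure_Ico_le ha hs)).trans_eq ?_
    congr 2
    field_simp
    ring
  refine ENNReal.toReal_le_of_le_ofReal (by positivity) ?_
  rw [← map_div_add_gammaMeasure ha hb one_pos, Measure.map_apply (by fun_prop) measurableSet_Ico,
    Measure.prod_apply_symm ((by fun_prop : Measurable fun x : ℝ × ℝ => x.1 / (x.1 + x.2))
      measurableSet_Ico)]
  refine (lintegral_mono_ae ((ae_pos_gammaMeasure b 1).mono hslice)).trans_eq ?_
  rw [lintegral_const, measure_univ, mul_one]

end Anticoncentration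

section Weights

variable {n : ℕ} {w : Fin n → ℝ}

lemma sum_normWeight_sq (w : Fin n → ℝ) : ∑ i, normWeight w i ^ 2 = 1 / nEff w := by
  simp only [normWeight, nEff, div_pow]
  rw [← Finset.sum_div, one_div_div]

lemma normWeight_le_one_div_sqrt_nEff (w : Fin n → ℝ) (i : Fin n) :
    normWeight w i ≤ 1 / √(nEff w) := by
  rw [one_div, ← Real.sqrt_inv, ← one_div, ← sum_normWeight_sq]
  exact Real.le_sqrt_of_sq_le (Finset.single_le_sum (f := fun i => normWeight w i ^ 2)
    (fun i _ => sq_nonneg _) (Finset.mem_univ i))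

lemma weightedCDF_eq_sum_ite (w ρ : Fin n → ℝ) (t : ℝ) :
    weightedCDF w ρ t = ∑ i, if ρ i ≤ t then normWeight w i else 0 := by
  simp only [weightedCDF, Set.indicator_apply, Set.mem_Iic, Pi.one_apply, mul_ite, mul_one,
    mul_zero]

variable [NeZero n]

lemma sum_weight_pos (hw : ∀ i, 0 < w i) : 0 < ∑ i, w i :=
  Finset.sum_pos (fun i _ => hw i) Finset.univ_nonempty

lemma normWeight_pos (hw : ∀ i, 0 < w i) (i : Fin n) : 0 < normWeight w i :=
  div_pos (hw i) (sum_weight_pos hw)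

lemma sum_normWeight (hw : ∀ i, 0 < w i) : ∑ i, normWeight w i = 1 := by
  simp only [normWeight]
  rw [← Finset.sum_div, div_self (sum_weight_pos hw).ne']

lemma nEff_pos (hw : ∀ i, 0 < w i) : 0 < nEff w :=
  div_pos (pow_pos (sum_weight_pos hw) 2)
    (Finset.sum_pos (fun i _ => pow_pos (hw i) 2) Finset.univ_nonempty)

lemma sortedWeight_mem_stdSimplex (hw : ∀ i, 0 < w i) (ρ : Fin n → ℝ) :
    sortedWeight ρ w ∈ stdSimplex ℝ (Fin n) :=
  ⟨fun _ => (normWeight_pos hw _).le,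
    (Equiv.sum_comp (Tuple.sort ρ) (normWeight w)).trans (sum_normWeight hw)⟩

end Weights

section Threshold

variable {n : ℕ}

/-- The positions of the sorted scores that are at most `t`. Both the weighted empirical
distribution function and the posterior distribution function at `t` are masses of this block. -/
noncomputable def scoresLE (ρ : Fin n → ℝ) (t : ℝ) : Finset (Fin n) :=
  Finset.univ.filter fun i => sortedScore ρ i ≤ t

lemma mem_scoresLE {ρ : Fin n → ℝ} {t : ℝ} {i : Fin n} :
    i ∈ scoresLE ρ t ↔ sortedScore ρ i ≤ t := by
  simp [scoresLE]

lemma scoresLE_mono (ρ : Fin n → ℝ) : Monotone (scoresLE ρ) := fun _ _ hst _ hi =>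
  mem_scoresLE.2 ((mem_scoresLE.1 hi).trans hst)

lemma sum_scoresLE_sortedWeight (ρ w : Fin n → ℝ) (t : ℝ) :
    ∑ i ∈ scoresLE ρ t, sortedWeight ρ w i = weightedCDF w ρ t := by
  rw [weightedCDF_eq_sum_ite, ← Equiv.sum_comp (Tuple.sort ρ), scoresLE, Finset.sum_filter]
  rfl

variable [NeZero n]

lemma le_cumSum_firstCrossing {v : Fin n → ℝ} {q : ℝ} (hq : q ≤ ∑ i, v i) :
    q ≤ cumSum v (firstCrossing q v) :=
  csInf_mem (s := {j | q ≤ cumSum v j}) ⟨⊤, by rwa [Set.mem_ofPred_eq, cumSum, Finset.Iic_top]⟩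

lemma cumSum_firstCrossing_lt {q : ℝ} (hq0 : 0 < q) (v : Fin n → ℝ) :
    cumSum v (firstCrossing q v) < q + v (firstCrossing q v) := by
  set K := firstCrossing q v
  rw [cumSum, ← Finset.Iio_insert, Finset.sum_insert (by simp), add_comm]
  gcongr
  by_cases hmin : IsMin K
  · rwa [Finset.Iio_eq_empty.2 hmin, Finset.sum_empty]
  · rw [← Finset.Iic_pred_eq_Iio_of_not_isMin hmin]
    exact not_le.1 (notMem_of_lt_csInf' (Order.pred_lt_of_not_isMin hmin) :)

lemma postThreshold_le_iff (ρ : Fin n → ℝ) {q : ℝ} (hq0 : 0 < q) (hq1 : q ≤ 1) {v : Fin n → ℝ}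
    (hv : v ∈ stdSimplex ℝ (Fin n)) (t : ℝ) :
    postThreshold ρ q v ≤ t ↔ q ≤ ∑ i ∈ scoresLE ρ t, v i := by
  have hsort : Monotone (sortedScore ρ) := Tuple.monotone_sort ρ
  have hsum {B B' : Finset (Fin n)} (h : B ⊆ B') : ∑ i ∈ B, v i ≤ ∑ i ∈ B', v i :=
    Finset.sum_le_sum_of_subset_of_nonneg h fun i _ _ => hv.1 i
  constructor
  · intro h
    have hK : q ≤ cumSum v (firstCrossing q v) := le_cumSum_firstCrossing (hv.2.symm ▸ hq1)
    exact hK.trans (hsum fun i hi => mem_scoresLE.2 ((hsort (Finset.mem_Iic.1 hi)).trans h))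
  · intro h
    have hne : (scoresLE ρ t).Nonempty := Finset.nonempty_of_sum_ne_zero (hq0.trans_le h).ne'
    refine le_trans (hsort (csInf_le' (a := (scoresLE ρ t).max' hne) ?_))
      (mem_scoresLE.1 (Finset.max'_mem _ hne))
    exact h.trans (hsum fun i hi => Finset.mem_Iic.2 (Finset.le_max' _ _ hi))

lemma weightedCDF_mono {w : Fin n → ℝ} (hw : ∀ i, 0 < w i) (ρ : Fin n → ℝ) :
    Monotone (weightedCDF w ρ) := by
  intro s t hst
  rw [← sum_scoresLE_sortedWeight, ← sum_scoresLE_sortedWeight]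
  exact Finset.sum_le_sum_of_subset_of_nonneg (scoresLE_mono ρ hst)
    fun i _ _ => (sortedWeight_mem_stdSimplex hw ρ).1 i

-- The conformal threshold is the posterior threshold at the mean of the posterior.
lemma wcpThreshold_eq_postThreshold {w : Fin n → ℝ} (hw : ∀ i, 0 < w i) (ρ : Fin n → ℝ) {q : ℝ}
    (hq0 : 0 < q) (hq1 : q ≤ 1) :
    wcpThreshold w ρ q = postThreshold ρ q (sortedWeight ρ w) := by
  simp only [wcpThreshold, ← sum_scoresLE_sortedWeight,
    ← postThreshold_le_iff ρ hq0 hq1 (sortedWeight_mem_stdSimplex hw ρ)]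
  exact csInf_Ici

lemma wcpThreshold_le_iff {w : Fin n → ℝ} (hw : ∀ i, 0 < w i) (ρ : Fin n → ℝ) {q : ℝ}
    (hq0 : 0 < q) (hq1 : q ≤ 1) (t : ℝ) : wcpThreshold w ρ q ≤ t ↔ q ≤ weightedCDF w ρ t := by
  rw [wcpThreshold_eq_postThreshold hw ρ hq0 hq1,
    postThreshold_le_iff ρ hq0 hq1 (sortedWeight_mem_stdSimplex hw ρ), sum_scoresLE_sortedWeight]

lemma measurable_firstCrossing (q : ℝ) : Measurable (firstCrossing (n := n) q) := by
  have h : firstCrossing (n := n) q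
      = (fun s : Fin n → Prop => sInf {j | s j}) ∘ fun v j => q ≤ cumSum v j := rfl
  rw [h]
  refine (Measurable.of_discrete).comp (measurable_pi_lambda _ fun j => ?_)
  have : MeasurableSet {v : Fin n → ℝ | q ≤ cumSum v j} :=
    measurableSet_le measurable_const (by unfold cumSum; fun_prop)
  exact measurableSet_setOfPred.1 this

lemma measurable_postThreshold (ρ : Fin n → ℝ) (q : ℝ) : Measurable (postThreshold ρ q) :=
  (Measurable.of_discrete (f := sortedScore ρ)).comp (measurable_firstCrossing q)

end Threshold

section Posterior

variable {n : ℕ} [NeZero n] {w : Fin n → ℝ} {c : ℝ}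

lemma posterior_param_pos (hw : ∀ i, 0 < w i) (hc : 0 < c) (ρ : Fin n → ℝ) (i : Fin n) :
    0 < c * sortedWeight ρ w i :=
  mul_pos hc (normWeight_pos hw _)

lemma isProbabilityMeasure_posterior (hw : ∀ i, 0 < w i) (hc : 0 < c) (ρ : Fin n → ℝ) :
    IsProbabilityMeasure (posterior ρ w c) :=
  isProbabilityMeasure_dirichlet (posterior_param_pos hw hc ρ)

lemma ae_mem_stdSimplex_posterior (hw : ∀ i, 0 < w i) (hc : 0 < c) (ρ : Fin n → ℝ) :
    ∀ᵐ v ∂posterior ρ w c, v ∈ stdSimplex ℝ (Fin n) :=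
  ae_mem_stdSimplex_dirichlet (posterior_param_pos hw hc ρ)

lemma memLp_sum_posterior (hw : ∀ i, 0 < w i) (hc : 0 < c) (ρ : Fin n → ℝ)
    (B : Finset (Fin n)) (p : ENNReal) : MemLp (fun v => ∑ i ∈ B, v i) p (posterior ρ w c) :=
  memLp_sum_dirichlet (posterior_param_pos hw hc ρ) B p

lemma integral_sum_posterior (hw : ∀ i, 0 < w i) (hc : 0 < c) (ρ : Fin n → ℝ)
    (B : Finset (Fin n)) :
    ∫ v, ∑ i ∈ B, v i ∂posterior ρ w c = ∑ i ∈ B, sortedWeight ρ w i := by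
  rw [posterior, integral_sum_dirichlet (posterior_param_pos hw hc ρ), ← Finset.mul_sum,
    ← Finset.mul_sum, (sortedWeight_mem_stdSimplex hw ρ).2, mul_one, mul_div_cancel_left₀ _ hc.ne']

lemma variance_sum_posterior (hw : ∀ i, 0 < w i) (hc : 0 < c) (ρ : Fin n → ℝ)
    (B : Finset (Fin n)) :
    variance (fun v => ∑ i ∈ B, v i) (posterior ρ w c)
      = (∑ i ∈ B, sortedWeight ρ w i) * (1 - ∑ i ∈ B, sortedWeight ρ w i) / (c + 1) := by
  rw [posterior, variance_sum_dirichlet (posterior_param_pos hw hc ρ), ← Finset.mul_sum,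
    ← Finset.mul_sum, (sortedWeight_mem_stdSimplex hw ρ).2, mul_one, mul_div_cancel_left₀ _ hc.ne']

lemma postVar_eq (hw : ∀ i, 0 < w i) (hc : 0 < c) (ρ : Fin n → ℝ) (j : Fin n) :
    postVar ρ w c j = cumSum (sortedWeight ρ w) j * (1 - cumSum (sortedWeight ρ w) j) / (c + 1) :=
  variance_sum_posterior hw hc ρ (Finset.Iic j)

lemma abs_weightedCDF_sub_le_of_not_iff (hw : ∀ i, 0 < w i) (ρ : Fin n → ℝ) {q : ℝ} (hq0 : 0 < q)
    (hq1 : q ≤ 1) {v : Fin n → ℝ} (hv : v ∈ stdSimplex ℝ (Fin n)) {t : ℝ}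
    (h : ¬(postThreshold ρ q v ≤ t ↔ wcpThreshold w ρ q ≤ t)) :
    |weightedCDF w ρ t - q| ≤ |∑ i ∈ scoresLE ρ t, v i - weightedCDF w ρ t| := by
  rw [postThreshold_le_iff ρ hq0 hq1 hv, wcpThreshold_le_iff hw ρ hq0 hq1] at h
  rw [abs_sub_comm (∑ i ∈ scoresLE ρ t, v i)]
  by_cases hF : q ≤ weightedCDF w ρ t
  · rw [abs_of_nonneg (sub_nonneg.2 hF)]
    have hv' : ∑ i ∈ scoresLE ρ t, v i < q := not_le.1 fun h' => h ⟨fun _ => hF, fun _ => h'⟩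
    exact (sub_le_sub_left hv'.le _).trans (le_abs_self _)
  · have hv' : q ≤ ∑ i ∈ scoresLE ρ t, v i := by_contra fun h' => h ⟨fun h => (h' h).elim,
      fun h => (hF h).elim⟩
    rw [abs_sub_comm, abs_of_nonneg (sub_nonneg.2 (not_le.1 hF).le), abs_sub_comm]
    exact (sub_le_sub_right hv' _).trans (le_abs_self _)

lemma posterior_real_not_postThreshold_le_iff_le (hw : ∀ i, 0 < w i) (hc : 0 < c)
    (ρ : Fin n → ℝ) {q : ℝ} (hq0 : 0 < q) (hq1 : q ≤ 1) {t : ℝ} (ht : weightedCDF w ρ t ≠ q) :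
    (posterior ρ w c).real {v | ¬(postThreshold ρ q v ≤ t ↔ wcpThreshold w ρ q ≤ t)}
      ≤ 1 / (weightedCDF w ρ t - q) ^ 2 / c := by
  have := isProbabilityMeasure_posterior hw hc ρ
  have hd : 0 < |weightedCDF w ρ t - q| := abs_pos.2 (sub_ne_zero.2 ht)
  have hcheb := meas_ge_le_variance_div_sq (memLp_sum_posterior hw hc ρ (scoresLE ρ t) 2) hd
  rw [integral_sum_posterior hw hc, variance_sum_posterior hw hc, sum_scoresLE_sortedWeight,
    sq_abs] at hcheb
  refine ENNReal.toReal_le_of_le_ofReal (by positivity) ?_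
  refine (measure_mono_ae ?_).trans (hcheb.trans (ENNReal.ofReal_le_ofReal ?_))
  · filter_upwards [ae_mem_stdSimplex_posterior hw hc ρ] with v hv h
    exact abs_weightedCDF_sub_le_of_not_iff hw ρ hq0 hq1 hv h
  · rw [div_right_comm]
    gcongr
    · nlinarith [sq_nonneg (weightedCDF w ρ t - 1 / 2)]
    · linarith

lemma map_sum_scoresLE_posterior (hw : ∀ i, 0 < w i) (hc : 0 < c) (ρ : Fin n → ℝ) {t : ℝ}
    (ht : weightedCDF w ρ t ∈ Set.Ioo (0 : ℝ) 1) :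
    (posterior ρ w c).map (fun v => ∑ i ∈ scoresLE ρ t, v i)
      = betaMeasure (c * weightedCDF w ρ t) (c * (1 - weightedCDF w ρ t)) := by
  have hcompl : ∑ i ∈ (scoresLE ρ t)ᶜ, sortedWeight ρ w i = 1 - weightedCDF w ρ t := by
    rw [eq_sub_iff_add_eq', ← sum_scoresLE_sortedWeight, Finset.sum_add_sum_compl,
      (sortedWeight_mem_stdSimplex hw ρ).2]
  have h0 : (scoresLE ρ t).Nonempty := Finset.nonempty_of_sum_ne_zero
    (f := sortedWeight ρ w) (by rw [sum_scoresLE_sortedWeight]; exact ht.1.ne')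
  have h1 : (scoresLE ρ t)ᶜ.Nonempty := Finset.nonempty_of_sum_ne_zero
    (f := sortedWeight ρ w) (by rw [hcompl]; exact (sub_pos.2 ht.2).ne')
  rw [posterior, map_sum_dirichlet (posterior_param_pos hw hc ρ) h0 h1, ← Finset.mul_sum,
    ← Finset.mul_sum, sum_scoresLE_sortedWeight, hcompl]

lemma posterior_real_postThreshold_le (hw : ∀ i, 0 < w i) (hc : 0 < c) (ρ : Fin n → ℝ) {q : ℝ}
    (hq0 : 0 < q) (hq1 : q ≤ 1) {t : ℝ} (ht : weightedCDF w ρ t ∈ Set.Ioo (0 : ℝ) 1) :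
    (posterior ρ w c).real {v | postThreshold ρ q v ≤ t}
      = (betaMeasure (c * weightedCDF w ρ t) (c * (1 - weightedCDF w ρ t))).real (Set.Ici q) := by
  rw [← map_sum_scoresLE_posterior hw hc ρ ht,
    map_measureReal_apply (by fun_prop) measurableSet_Ici]
  refine measureReal_congr ?_
  filter_upwards [ae_mem_stdSimplex_posterior hw hc ρ] with v hv
  exact propext (postThreshold_le_iff ρ hq0 hq1 hv t)

lemma posterior_real_le_sum_le (hw : ∀ i, 0 < w i) (hc : 0 < c) (ρ : Fin n → ℝ)
    (B : Finset (Fin n)) {η : ℝ} (hη : 0 < η) :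
    (posterior ρ w c).real {v | η ≤ ∑ i ∈ B, v i} ≤ (∑ i ∈ B, sortedWeight ρ w i) / η := by
  have := isProbabilityMeasure_posterior hw hc ρ
  rw [le_div_iff₀ hη, mul_comm, ← integral_sum_posterior hw hc]
  refine mul_meas_ge_le_integral_of_nonneg ?_
    ((memLp_sum_posterior hw hc ρ B 1).integrable le_rfl) η
  filter_upwards [ae_mem_stdSimplex_posterior hw hc ρ] with v hv
  exact Finset.sum_nonneg fun i _ => hv.1 i

-- If the threshold falls in `(s, t]`, then either the block of scores in `(s, t]` has mass at least
-- `η`, or the mass of the scores up to `s` falls short of `q` by at most `η`.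
lemma posterior_real_postThreshold_mem_Ioc_le (hw : ∀ i, 0 < w i) (hc : 0 < c) (ρ : Fin n → ℝ)
    {q : ℝ} (hq0 : 0 < q) (hq1 : q < 1) {s t : ℝ} (hst : s ≤ t)
    (hs : weightedCDF w ρ s ∈ Set.Ioo (0 : ℝ) 1) {η : ℝ} (hη : 0 < η) (hηq : η < q) :
    (posterior ρ w c).real {v | postThreshold ρ q v ∈ Set.Ioc s t}
      ≤ (weightedCDF w ρ t - weightedCDF w ρ s) / η
        + √c * Real.exp (1 / 2) * (η / ((1 - q) * (q - η))) := by
  have := isProbabilityMeasure_posterior hw hc ρ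
  set D := scoresLE ρ t \ scoresLE ρ s
  have hsplit (v : Fin n → ℝ) :
      ∑ i ∈ D, v i + ∑ i ∈ scoresLE ρ s, v i = ∑ i ∈ scoresLE ρ t, v i :=
    Finset.sum_sdiff (scoresLE_mono ρ hst)
  have hblock := posterior_real_le_sum_le hw hc ρ D hη
  rw [eq_sub_of_add_eq (hsplit (sortedWeight ρ w)), sum_scoresLE_sortedWeight,
    sum_scoresLE_sortedWeight] at hblock
  have hnear : (posterior ρ w c).real {v | ∑ i ∈ scoresLE ρ s, v i ∈ Set.Ico (q - η) q}
      ≤ √c * Real.exp (1 / 2) * (η / ((1 - q) * (q - η))) := by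
    have h := betaMeasure_real_Ico_le (mul_pos hc hs.1) (mul_pos hc (sub_pos.2 hs.2)) hη.le hηq hq1
    rw [← map_sum_scoresLE_posterior hw hc ρ hs,
      map_measureReal_apply (by fun_prop) measurableSet_Ico] at h
    refine h.trans ?_
    gcongr
    exact mul_le_of_le_one_right hc.le hs.2.le
  refine le_trans (ENNReal.toReal_mono (measure_ne_top _ _) (measure_mono_ae ?_))
    ((measureReal_union_le _ _).trans (add_le_add hblock hnear))
  filter_upwards [ae_mem_stdSimplex_posterior hw hc ρ] with v hv ⟨hs', ht'⟩
  have hlt := not_le.1 (mt (postThreshold_le_iff ρ hq0 hq1.le hv s).2 (not_le.2 hs'))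
  have hle := (postThreshold_le_iff ρ hq0 hq1.le hv t).1 ht'
  rw [← hsplit] at hle
  rcases le_or_gt η (∑ i ∈ D, v i) with hD | hD
  · exact Or.inl hD
  · exact Or.inr ⟨by linarith, hlt⟩

lemma abs_integral_sub_le_mul_measureReal_ne {Ω : Type*} [MeasurableSpace Ω] {μ : Measure Ω}
    [IsProbabilityMeasure μ] {X : Ω → ℝ} (hX : Measurable X) {a D : ℝ}
    (hD : ∀ ω, |X ω - a| ≤ D) : |∫ ω, X ω ∂μ - a| ≤ D * μ.real {ω | X ω ≠ a} := by
  have hint : Integrable (fun ω => X ω - a) μ :=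
    .of_bound (by fun_prop) D (ae_of_all _ hD)
  have hXint : Integrable X μ :=
    (hint.add (integrable_const a)).congr (ae_of_all _ fun ω => sub_add_cancel (X ω) a)
  have hsub : ∫ ω, X ω ∂μ - a = ∫ ω in {ω | X ω ≠ a}, (X ω - a) ∂μ := by
    rw [setIntegral_eq_integral_of_forall_compl_eq_zero (f := fun ω => X ω - a)
      (s := {ω | X ω ≠ a}) fun ω hω => sub_eq_zero.2 (not_not.1 hω),
      integral_sub hXint (integrable_const a), integral_const, probReal_univ, one_smul]
  rw [hsub]
  exact norm_setIntegral_le_of_norm_le_const (f := fun ω => X ω - a) (measure_lt_top μ _)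
    fun ω _ => hD ω

lemma exists_posterior_real_postThreshold_ne_le (hw : ∀ i, 0 < w i) (ρ : Fin n → ℝ) {q : ℝ}
    (hq0 : 0 < q) (hq1 : q ≤ 1) (hne : weightedCDF w ρ (wcpThreshold w ρ q) ≠ q) :
    ∃ C : ℝ, ∀ c : ℝ, 0 < c →
      (posterior ρ w c).real {v | postThreshold ρ q v ≠ wcpThreshold w ρ q} ≤ C / c := by
  set θ := wcpThreshold w ρ q
  set I := Finset.univ.filter fun j => weightedCDF w ρ (sortedScore ρ j) ≠ q with hI
  refine ⟨∑ j ∈ I, 1 / (weightedCDF w ρ (sortedScore ρ j) - q) ^ 2, fun c hc => ?_⟩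
  have := isProbabilityMeasure_posterior hw hc ρ
  have hsub : {v | postThreshold ρ q v ≠ θ} ⊆
      ⋃ j ∈ I, {v | ¬(postThreshold ρ q v ≤ sortedScore ρ j ↔ θ ≤ sortedScore ρ j)} := by
    intro v (hv : _ ≠ _)
    simp only [hI, Set.mem_iUnion, Finset.mem_filter, Finset.mem_univ, true_and, exists_prop]
    rcases lt_or_gt_of_ne hv with h | h
    · refine ⟨firstCrossing q v, fun hq => ?_, fun h' => not_le.2 h (h'.1 le_rfl)⟩
      exact not_le.2 h ((wcpThreshold_le_iff hw ρ hq0 hq1 _).2 hq.ge)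
    · have hθ : θ = sortedScore ρ (firstCrossing q (sortedWeight ρ w)) :=
        wcpThreshold_eq_postThreshold hw ρ hq0 hq1
      exact ⟨_, hθ ▸ hne, fun h' => not_le.2 h (hθ ▸ h'.2 hθ.le)⟩
  refine (measureReal_mono hsub (measure_ne_top _ _)).trans
    ((measureReal_biUnion_finset_le _ _).trans ?_)
  rw [Finset.sum_div]
  exact Finset.sum_le_sum fun j hj =>
    posterior_real_not_postThreshold_le_iff_le hw hc ρ hq0 hq1 (Finset.mem_filter.1 hj).2

lemma exists_abs_integral_postThreshold_sub_le (hw : ∀ i, 0 < w i) (ρ : Fin n → ℝ) {q : ℝ}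
    (hq0 : 0 < q) (hq1 : q ≤ 1) (hne : weightedCDF w ρ (wcpThreshold w ρ q) ≠ q) :
    ∃ C : ℝ, ∀ c : ℝ, 0 < c →
      |(∫ v, postThreshold ρ q v ∂(posterior ρ w c)) - wcpThreshold w ρ q| ≤ C / c := by
  obtain ⟨C, hC⟩ := exists_posterior_real_postThreshold_ne_le hw ρ hq0 hq1 hne
  set D := ∑ j, |sortedScore ρ j - wcpThreshold w ρ q|
  have hD (v : Fin n → ℝ) : |postThreshold ρ q v - wcpThreshold w ρ q| ≤ D :=
    Finset.single_le_sum (f := fun j => |sortedScore ρ j - wcpThreshold w ρ q|)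
      (fun j _ => abs_nonneg _) (Finset.mem_univ (firstCrossing q v))
  refine ⟨D * C, fun c hc => ?_⟩
  have := isProbabilityMeasure_posterior hw hc ρ
  refine (abs_integral_sub_le_mul_measureReal_ne (measurable_postThreshold ρ q) hD).trans ?_
  rw [mul_div_assoc]
  exact mul_le_mul_of_nonneg_left (hC c hc) (Finset.sum_nonneg fun j _ => abs_nonneg _)

end Posterior

section Product

variable {ι Ω : Type*} [Fintype ι] [MeasurableSpace Ω] {P : Measure Ω} [IsProbabilityMeasure P]
  {g : Ω → ℝ}

lemma memLp_sum_mul_eval (a : ι → ℝ) {p : ENNReal} (hg : MemLp g p P) :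
    MemLp (fun x : ι → Ω => ∑ i, a i * g (x i)) p (Measure.pi fun _ => P) :=
  memLp_finsetSum _ fun i _ =>
    (hg.comp_measurePreserving (measurePreserving_eval (fun _ => P) i)).const_mul (a i)

lemma integral_sum_mul_eval (a : ι → ℝ) (hg : Integrable g P) :
    ∫ x : ι → Ω, ∑ i, a i * g (x i) ∂(Measure.pi fun _ => P) = (∑ i, a i) * ∫ y, g y ∂P := by
  rw [integral_finsetSum _ fun i _ => (integrable_comp_eval hg).const_mul (a i), Finset.sum_mul]
  refine Finset.sum_congr rfl fun i _ => ?_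
  rw [integral_const_mul, integral_comp_eval (μ := fun _ => P) hg.aestronglyMeasurable]

lemma variance_sum_mul_eval (a : ι → ℝ) (hg : MemLp g 2 P) :
    variance (fun x : ι → Ω => ∑ i, a i * g (x i)) (Measure.pi fun _ => P)
      = (∑ i, a i ^ 2) * variance g P := by
  have h := variance_sum_pi (μ := fun _ : ι => P) (X := fun i x => a i * g x)
    fun i => hg.const_mul (a i)
  simp only [variance_const_mul, ← Finset.sum_mul] at h
  rw [← h]
  congr 1
  ext x
  simp

lemma iIndepFun_mul_eval (a : ι → ℝ) (hg : Measurable g) :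
    iIndepFun (fun i (x : ι → Ω) => a i * g (x i)) (Measure.pi fun _ => P) :=
  iIndepFun_pi (X := fun i x => a i * g x) fun i => (hg.const_mul (a i)).aemeasurable

lemma hasSubgaussianMGF_sum_mul_eval (a : ι → ℝ) (hgm : Measurable g) {c : NNReal}
    (hg : HasSubgaussianMGF g c P) :
    HasSubgaussianMGF (fun x : ι → Ω => ∑ i, a i * g (x i))
      (∑ i, NNReal.mk (a i ^ 2) (sq_nonneg _) * c) (Measure.pi fun _ => P) :=
  .sum_of_iIndepFun (iIndepFun_mul_eval a hgm) fun i _ =>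
    .const_mul (.of_map (Y := Function.eval i) (measurable_pi_apply i).aemeasurable <| by
      rwa [(measurePreserving_eval (fun _ => P) i).map_eq]) _

end Product

section Moments

variable {Ω : Type*} [MeasurableSpace Ω] {μ : Measure Ω}

lemma variance_indicator_one [IsProbabilityMeasure μ] {s : Set Ω} (hs : MeasurableSet s) :
    variance (s.indicator 1) μ = μ.real s * (1 - μ.real s) := by
  have hsq : (s.indicator 1 : Ω → ℝ) ^ 2 = s.indicator 1 := by
    ext x
    by_cases hx : x ∈ s <;> simp [hx]
  have hmem : MemLp (s.indicator (1 : Ω → ℝ)) 2 μ :=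
    memLp_indicator_const 2 hs 1 (.inr (measure_ne_top _ _))
  rw [variance_eq_sub hmem, hsq, integral_indicator_one hs]
  ring

lemma integral_pow_four_le {X : Ω → ℝ} {c : NNReal} (h : HasSubgaussianMGF X c μ) :
    ∫ ω, X ω ^ 4 ∂μ ≤ 48 * Real.exp (c / 2) := by
  have hpt : ∀ x : ℝ, x ^ 4 ≤ 24 * (Real.exp (1 * x) + Real.exp (-1 * x)) := fun x => by
    have h4 := Real.pow_div_factorial_le_exp |x| (abs_nonneg x) 4
    rw [Even.pow_abs (by decide), div_le_iff₀ (by positivity)] at h4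
    have hexp := Real.exp_abs_le x
    norm_num [Nat.factorial] at h4 ⊢
    linarith
  have hint : Integrable (fun ω => X ω ^ 4) μ := by
    simpa [Even.pow_abs (show Even 4 by decide)] using
      (h.memLp 4).integrable_norm_pow (p := 4) (by simp)
  calc ∫ ω, X ω ^ 4 ∂μ ≤ ∫ ω, 24 * (Real.exp (1 * X ω) + Real.exp (-1 * X ω)) ∂μ :=
        integral_mono hint
          (((h.integrable_exp_mul 1).add (h.integrable_exp_mul (-1))).const_mul 24)
          fun ω => hpt (X ω)
    _ = 24 * (mgf X μ 1 + mgf X μ (-1)) := by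
        rw [integral_const_mul, integral_add (h.integrable_exp_mul 1) (h.integrable_exp_mul (-1))]
        rfl
    _ ≤ 48 * Real.exp (c / 2) := by
        have h1 := h.mgf_le 1
        have h2 := h.mgf_le (-1)
        norm_num at h1 h2
        linarith

end Moments

section EmpiricalCDF

variable {n : ℕ} {w : Fin n → ℝ} {P : Measure ℝ} [IsProbabilityMeasure P]

instance isProbabilityMeasure_sampling : IsProbabilityMeasure (sampling n P) := by
  unfold sampling
  infer_instance

lemma measurable_indicator_Iic (t : ℝ) : Measurable ((Set.Iic t).indicator (1 : ℝ → ℝ)) :=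
  measurable_one.indicator measurableSet_Iic

@[fun_prop]
lemma measurable_weightedCDF (w : Fin n → ℝ) (t : ℝ) : Measurable fun ρ => weightedCDF w ρ t := by
  unfold weightedCDF
  have := measurable_indicator_Iic t
  fun_prop

lemma memLp_indicator_Iic (t : ℝ) (p : ENNReal) : MemLp ((Set.Iic t).indicator (1 : ℝ → ℝ)) p P :=
  memLp_indicator_const p measurableSet_Iic 1 (.inr (measure_ne_top _ _))

lemma integral_indicator_Iic (t : ℝ) : ∫ x, (Set.Iic t).indicator (1 : ℝ → ℝ) x ∂P = cdf P t := by
  rw [integral_indicator_one measurableSet_Iic, cdf_eq_real]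

lemma memLp_weightedCDF (w : Fin n → ℝ) (t : ℝ) (p : ENNReal) :
    MemLp (fun ρ => weightedCDF w ρ t) p (sampling n P) :=
  memLp_sum_mul_eval (normWeight w) (memLp_indicator_Iic t p)

lemma integral_weightedCDF [NeZero n] (hw : ∀ i, 0 < w i) (t : ℝ) :
    ∫ ρ, weightedCDF w ρ t ∂(sampling n P) = cdf P t := by
  refine (integral_sum_mul_eval _ ((memLp_indicator_Iic t 1).integrable le_rfl)).trans ?_
  rw [integral_indicator_Iic, sum_normWeight hw, one_mul]

lemma freqVar_eq (w : Fin n → ℝ) (P : Measure ℝ) [IsProbabilityMeasure P] (t : ℝ) :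
    freqVar w P t = cdf P t * (1 - cdf P t) / nEff w := by
  refine (variance_sum_mul_eval _ (memLp_indicator_Iic t 2)).trans ?_
  rw [sum_normWeight_sq, variance_indicator_one measurableSet_Iic, ← cdf_eq_real]
  ring

lemma variance_indicator_Iic_sub_le (s t : ℝ) :
    variance ((Set.Iic t).indicator 1 - (Set.Iic s).indicator 1) P ≤ |cdf P t - cdf P s| := by
  wlog hst : s ≤ t generalizing s t
  · rw [← neg_sub, variance_neg, abs_sub_comm]
    exact this t s (le_of_not_ge hst)
  have hIoc : P.real (Set.Ioc s t) = cdf P t - cdf P s := by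
    rw [← Set.Iic_sdiff_Iic, measureReal_sdiff (Set.Iic_subset_Iic.2 hst) measurableSet_Iic,
      cdf_eq_real, cdf_eq_real]
  rw [← Set.indicator_sdiff (Set.Iic_subset_Iic.2 hst), Set.Iic_sdiff_Iic,
    variance_indicator_one measurableSet_Ioc, ← hIoc]
  exact (mul_le_of_le_one_right measureReal_nonneg (by simp)).trans (le_abs_self _)

lemma variance_weightedCDF_sub_le (w : Fin n → ℝ) (s t : ℝ) :
    variance (fun ρ => weightedCDF w ρ t - weightedCDF w ρ s) (sampling n P)
      ≤ |cdf P t - cdf P s| / nEff w := by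
  have hsum : (fun ρ => weightedCDF w ρ t - weightedCDF w ρ s) = fun ρ => ∑ i, normWeight w i *
      ((Set.Iic t).indicator 1 - (Set.Iic s).indicator 1 : ℝ → ℝ) (ρ i) := by
    simp only [weightedCDF, ← Finset.sum_sub_distrib, ← mul_sub, Pi.sub_apply]
  rw [hsum, sampling, variance_sum_mul_eval _ ((memLp_indicator_Iic t 2).sub
    (memLp_indicator_Iic s 2)), sum_normWeight_sq, one_div_mul_eq_div]
  gcongr
  · exact div_nonneg (sq_nonneg _) (by positivity)
  · exact variance_indicator_Iic_sub_le s t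

variable [NeZero n]

lemma sum_scaled_normWeight_sq (hw : ∀ i, 0 < w i) :
    ∑ i, (√(nEff w) * normWeight w i) ^ 2 = 1 := by
  simp only [mul_pow, ← Finset.mul_sum, sum_normWeight_sq, Real.sq_sqrt (nEff_pos hw).le]
  rw [mul_one_div, div_self (nEff_pos hw).ne']

lemma scaled_weightedCDF_sub_eq_sum (hw : ∀ i, 0 < w i) (ρ : Fin n → ℝ) (t p : ℝ) :
    √(nEff w) * (weightedCDF w ρ t - p)
      = ∑ i, √(nEff w) * normWeight w i * ((Set.Iic t).indicator 1 (ρ i) - p) := by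
  simp only [weightedCDF, mul_sub, Finset.sum_sub_distrib, ← Finset.sum_mul, ← Finset.mul_sum,
    sum_normWeight hw, one_mul, mul_assoc]

lemma hasSubgaussianMGF_scaled_weightedCDF_sub_cdf (hw : ∀ i, 0 < w i) (t : ℝ) :
    HasSubgaussianMGF (fun ρ => √(nEff w) * (weightedCDF w ρ t - cdf P t)) (1 / 4)
      (sampling n P) := by
  have hind : HasSubgaussianMGF (fun x => (Set.Iic t).indicator (1 : ℝ → ℝ) x - cdf P t)
      ((‖(1 : ℝ) - 0‖₊ / 2) ^ 2) P := by
    rw [← integral_indicator_Iic]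
    exact hasSubgaussianMGF_of_mem_Icc (measurable_indicator_Iic t).aemeasurable
      (ae_of_all _ fun x => ⟨Set.indicator_nonneg (fun _ _ => zero_le_one) x,
        Set.indicator_le_self' (f := 1) (by simp) x⟩)
  simp only [scaled_weightedCDF_sub_eq_sum hw _ t (cdf P t)]
  convert hasSubgaussianMGF_sum_mul_eval (fun i => √(nEff w) * normWeight w i)
    ((measurable_indicator_Iic t).sub_const _) hind
  · rw [← Finset.sum_mul]
    ext
    push_cast
    simp only [sum_scaled_normWeight_sq hw]
    norm_num
  · rfl

end EmpiricalCDF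

section CentralLimit

lemma norm_prod_sub_prod_le {ι : Type*} (s : Finset ι) {z u : ι → ℂ} (hz : ∀ i ∈ s, ‖z i‖ ≤ 1)
    (hu : ∀ i ∈ s, ‖u i‖ ≤ 1) : ‖∏ i ∈ s, z i - ∏ i ∈ s, u i‖ ≤ ∑ i ∈ s, ‖z i - u i‖ := by
  induction s using Finset.cons_induction with
  | empty => simp
  | cons a s ha ih =>
    obtain ⟨hza, hzs⟩ := Finset.forall_mem_cons ha _ |>.1 hz
    obtain ⟨-, hus⟩ := Finset.forall_mem_cons ha _ |>.1 hu
    have hprod : ‖∏ i ∈ s, u i‖ ≤ 1 := by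
      rw [norm_prod]
      exact Finset.prod_le_one (fun _ _ => norm_nonneg _) hus
    rw [Finset.prod_cons, Finset.prod_cons, Finset.sum_cons]
    calc ‖z a * ∏ i ∈ s, z i - u a * ∏ i ∈ s, u i‖
        = ‖(z a - u a) * ∏ i ∈ s, u i + z a * (∏ i ∈ s, z i - ∏ i ∈ s, u i)‖ := by ring_nf
      _ ≤ ‖z a - u a‖ * ‖∏ i ∈ s, u i‖ + ‖z a‖ * ‖∏ i ∈ s, z i - ∏ i ∈ s, u i‖ := by
        rw [← norm_mul, ← norm_mul]
        exact norm_add_le _ _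
      _ ≤ _ := add_le_add (mul_le_of_le_one_right (norm_nonneg _) hprod)
        ((mul_le_of_le_one_left (norm_nonneg _) hza).trans (ih hzs hus))

lemma abs_exp_neg_sub_one_sub_le {y : ℝ} (hy : 0 ≤ y) : |Real.exp (-y) - (1 - y)| ≤ y ^ 2 := by
  rw [abs_of_nonneg (sub_nonneg.2 (Real.one_sub_le_exp_neg y))]
  have hmul : Real.exp (-y) * (1 + y) ≤ 1 := by
    rw [Real.exp_neg, inv_mul_le_one₀ (Real.exp_pos y)]
    linarith [Real.add_one_le_exp y]
  have hpos : 1 ≤ (1 + y) * (1 - y + y ^ 2) := by nlinarith [pow_nonneg hy 3]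
  have := le_of_mul_le_mul_right ((hmul.trans hpos).trans_eq (mul_comm _ _)) (by positivity)
  linarith

lemma norm_exp_mul_I_sub_le (x : ℝ) :
    ‖Complex.exp (x * Complex.I) - (1 + x * Complex.I + (-(x ^ 2 / 2) : ℝ))‖
      ≤ |x| ^ 3 * Real.exp |x| := by
  have h := Complex.norm_exp_sub_sum_le_norm_mul_exp (x * Complex.I) 3
  simp only [Finset.sum_range_succ, Finset.sum_range_zero, norm_mul, Complex.norm_I, mul_one,
    Complex.norm_real, Real.norm_eq_abs, mul_pow, Complex.I_sq] at h
  convert h using 3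
  push_cast
  simp [Nat.factorial]
  ring

variable {Ω : Type*} [MeasurableSpace Ω] {μ : Measure Ω} [IsProbabilityMeasure μ]

lemma norm_charFun_map_sub_le {X : Ω → ℝ} {a : ℝ} (hX : AEMeasurable X μ)
    (ha : ∀ᵐ ω ∂μ, |X ω| ≤ a) (hmean : ∫ ω, X ω ∂μ = 0) (t : ℝ) :
    ‖charFun (μ.map X) t - (1 - t ^ 2 * variance X μ / 2 : ℝ)‖
      ≤ |t| ^ 3 * a * Real.exp (|t| * a) * variance X μ := by
  have hmem (p : ENNReal) : MemLp X p μ := .of_bound hX.aestronglyMeasurable a ha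
  have hint : Integrable X μ := (hmem 1).integrable le_rfl
  have hexp : Integrable (fun ω => Complex.exp ((t * X ω : ℝ) * Complex.I)) μ :=
    .of_bound (by fun_prop) 1 (ae_of_all _ fun ω => (Complex.norm_exp_ofReal_mul_I _).le)
  have hlin : Integrable (fun ω => 1 + ((t * X ω : ℝ) : ℂ) * Complex.I) μ :=
    (integrable_const 1).add ((hint.const_mul t).ofReal.mul_const _)
  have hsq : Integrable (fun ω => (-((t * X ω) ^ 2 / 2))) μ := by
    simpa only [mul_pow, Pi.neg_def] using
      (((hmem 2).integrable_sq.const_mul (t ^ 2)).div_const 2).neg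
  have hpoly : Integrable (fun ω => 1 + ((t * X ω : ℝ) : ℂ) * Complex.I
      + (-((t * X ω) ^ 2 / 2) : ℝ)) μ := hlin.add hsq.ofReal
  have htaylor : charFun (μ.map X) t - (1 - t ^ 2 * variance X μ / 2 : ℝ)
      = ∫ ω, (Complex.exp ((t * X ω : ℝ) * Complex.I)
          - (1 + (t * X ω : ℝ) * Complex.I + (-((t * X ω) ^ 2 / 2) : ℝ))) ∂μ := by
    rw [integral_sub hexp hpoly, integral_add (g := fun ω => ((-((t * X ω) ^ 2 / 2) : ℝ) : ℂ))
      hlin hsq.ofReal, integral_add (integrable_const 1)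
      ((hint.const_mul t).ofReal.mul_const _), integral_mul_const, integral_complex_ofReal,
      integral_complex_ofReal, integral_const_mul, hmean,
      variance_of_integral_eq_zero hX hmean, charFun_apply_real, integral_map hX (by fun_prop)]
    simp only [mul_pow, integral_neg, integral_div, integral_const_mul]
    simp only [Complex.ofReal_sub, Complex.ofReal_one, Complex.ofReal_div, Complex.ofReal_mul,
      Complex.ofReal_pow, Complex.ofReal_ofNat, integral_const, probReal_univ, one_smul, mul_zero,
      Complex.ofReal_zero, zero_mul, add_zero, Complex.ofReal_neg]
    ring
  rw [htaylor, variance_of_integral_eq_zero hX hmean, ← integral_const_mul]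
  refine norm_integral_le_of_norm_le ((hmem 2).integrable_sq.const_mul _) ?_
  filter_upwards [ha] with ω hω
  have ha0 : 0 ≤ a := (abs_nonneg _).trans hω
  calc _ ≤ |t * X ω| ^ 3 * Real.exp |t * X ω| := norm_exp_mul_I_sub_le _
    _ = |t| ^ 3 * |X ω| * Real.exp (|t| * |X ω|) * X ω ^ 2 := by
      rw [abs_mul, ← sq_abs (X ω)]
      ring
    _ ≤ |t| ^ 3 * a * Real.exp (|t| * a) * X ω ^ 2 := by gcongr

variable {ι : Type*} [Fintype ι] {X : ι → Ω → ℝ} {a : ℝ}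

lemma norm_charFun_map_sum_sub_exp_le (hX : ∀ i, AEMeasurable (X i) μ) (hindep : iIndepFun X μ)
    (ha : ∀ i, ∀ᵐ ω ∂μ, |X i ω| ≤ a) (hmean : ∀ i, ∫ ω, X i ω ∂μ = 0) (t : ℝ) :
    ‖charFun (μ.map fun ω => ∑ i, X i ω) t
        - Real.exp (-(t ^ 2 * (∑ i, variance (X i) μ) / 2))‖
      ≤ (|t| ^ 3 * a * Real.exp (|t| * a) + t ^ 4 * a ^ 2) * ∑ i, variance (X i) μ := by
  have hprob := fun i => Measure.isProbabilityMeasure_map (hX i)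
  have hsplit : (Real.exp (-(t ^ 2 * (∑ i, variance (X i) μ) / 2)) : ℂ)
      = ∏ i, (Real.exp (-(t ^ 2 * variance (X i) μ / 2)) : ℂ) := by
    rw [← Complex.ofReal_prod, ← Real.exp_sum]
    simp only [Finset.sum_neg_distrib, ← Finset.sum_div, Finset.mul_sum]
  rw [hindep.charFun_map_fun_sum_eq_prod hX, Finset.prod_apply, hsplit, Finset.mul_sum]
  refine (norm_prod_sub_prod_le _ (fun i _ => norm_charFun_le_one _) fun i _ => ?_).trans
    (Finset.sum_le_sum fun i _ => ?_)
  · rw [Complex.norm_real, Real.norm_of_nonneg (Real.exp_pos _).le, Real.exp_le_one_iff]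
    have := variance_nonneg (X i) μ
    simp only [Left.neg_nonpos_iff]
    positivity
  · set V := variance (X i) μ
    have hV : 0 ≤ V := variance_nonneg _ _
    have hVa : V ≤ a ^ 2 := by
      have h := variance_le_sq_of_bounded ((ha i).mono fun ω hω => abs_le.1 hω) (hX i)
      linarith [show ((a - -a) / 2) ^ 2 = a ^ 2 by ring]
    have hexp := abs_exp_neg_sub_one_sub_le (y := t ^ 2 * V / 2) (by positivity)
    rw [← Real.norm_eq_abs, ← Complex.norm_real, Complex.ofReal_sub, norm_sub_rev] at hexp
    calc ‖charFun (μ.map (X i)) t - Real.exp (-(t ^ 2 * V / 2))‖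
        ≤ |t| ^ 3 * a * Real.exp (|t| * a) * V + (t ^ 2 * V / 2) ^ 2 :=
          (norm_sub_le_norm_sub_add_norm_sub _ _ _).trans
            (add_le_add (norm_charFun_map_sub_le (hX i) (ha i) (hmean i) t) hexp)
      _ ≤ |t| ^ 3 * a * Real.exp (|t| * a) * V + t ^ 4 * a ^ 2 * V := by
          have : V * V ≤ a ^ 2 * V := mul_le_mul_of_nonneg_right hVa hV
          nlinarith [mul_le_mul_of_nonneg_left this (show 0 ≤ t ^ 4 by positivity),
            mul_nonneg (show 0 ≤ t ^ 4 by positivity) (mul_nonneg hV hV)]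
      _ = _ := (add_mul _ _ _).symm

lemma tendsto_charFun_map_sum {κ : Type*} {l : Filter κ} {ι Ω : κ → Type*} [∀ k, Fintype (ι k)]
    [∀ k, MeasurableSpace (Ω k)] {μ : ∀ k, Measure (Ω k)} [∀ k, IsProbabilityMeasure (μ k)]
    {X : ∀ k, ι k → Ω k → ℝ} (hX : ∀ k i, AEMeasurable (X k i) (μ k))
    (hindep : ∀ k, iIndepFun (X k) (μ k))
    (hbound : ∀ ε > 0, ∀ᶠ k in l, ∀ i, ∀ᵐ ω ∂(μ k), |X k i ω| ≤ ε)
    (hmean : ∀ k i, ∫ ω, X k i ω ∂(μ k) = 0) {v : ℝ}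
    (hvar : Tendsto (fun k => ∑ i, variance (X k i) (μ k)) l (𝓝 v)) (t : ℝ) :
    Tendsto (fun k => charFun ((μ k).map fun ω => ∑ i, X k i ω) t) l
      (𝓝 (Real.exp (-(t ^ 2 * v / 2)) : ℂ)) := by
  have hexp : Tendsto (fun k => (Real.exp (-(t ^ 2 * (∑ i, variance (X k i) (μ k)) / 2)) : ℂ)) l
      (𝓝 (Real.exp (-(t ^ 2 * v / 2)) : ℂ)) :=
    (Complex.continuous_ofReal.tendsto _).comp <| (Real.continuous_exp.tendsto _).comp
      ((hvar.const_mul _).div_const _).neg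
  have hK : Tendsto (fun a => (|t| ^ 3 * a * Real.exp (|t| * a) + t ^ 4 * a ^ 2) * (v + 1))
      (𝓝[>] 0) (𝓝 0) := by
    refine Tendsto.mono_left (Continuous.tendsto' (by fun_prop) _ _ ?_) nhdsWithin_le_nhds
    simp
  refine hexp.congr_dist (Metric.tendsto_nhds.2 fun ε hε => ?_)
  obtain ⟨a, ha, hKa⟩ := ((hK.eventually_lt_const hε).and self_mem_nhdsWithin).exists.imp
    fun _ h => h.symm
  filter_upwards [hbound a ha, hvar.eventually_le_const (lt_add_one v)] with k hk hv
  rw [dist_zero_right, Real.norm_of_nonneg dist_nonneg, dist_comm, dist_eq_norm]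
  refine (norm_charFun_map_sum_sub_exp_le (hX k) (hindep k) hk (hmean k) t).trans_lt
    (lt_of_le_of_lt ?_ hKa)
  gcongr

end CentralLimit

section WeightedEmpirical

variable {P : Measure ℝ} [IsProbabilityMeasure P] {m : ℕ → ℕ} [∀ k, NeZero (m k)]
  {w : ∀ k, Fin (m k) → ℝ} {s : ℕ → ℝ} {q d : ℝ}

lemma abs_indicator_one_sub_le {α : Type*} (A : Set α) {p : ℝ} (hp0 : 0 ≤ p) (hp1 : p ≤ 1)
    (x : α) : |A.indicator 1 x - p| ≤ 1 := by
  by_cases h : x ∈ A <;> simp only [h, Set.indicator_of_mem, Set.indicator_of_notMem,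
    Pi.one_apply, not_false_eq_true, abs_le] <;> constructor <;> linarith

lemma sum_variance_mul_eval {ι : Type*} [Fintype ι] (a : ι → ℝ) {g : ℝ → ℝ} (hg : Measurable g) :
    ∑ i, variance (fun x : ι → ℝ => a i * g (x i)) (Measure.pi fun _ => P)
      = (∑ i, a i ^ 2) * variance g P := by
  simp only [variance_const_mul, Finset.sum_mul]
  exact Finset.sum_congr rfl fun i _ => congrArg _
    ((measurePreserving_eval (fun _ => P) i).variance_fun_comp hg.aemeasurable)

lemma tendsto_charFun_map_scaled_weightedCDF (hw : ∀ k i, 0 < w k i)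
    (hmax : ∀ ε > 0, ∀ᶠ k in atTop, ∀ i, √(nEff (w k)) * normWeight (w k) i ≤ ε)
    (hs : Tendsto (fun k => cdf P (s k)) atTop (𝓝 q)) (t : ℝ) :
    Tendsto (fun k => charFun ((sampling (m k) P).map fun ρ =>
        √(nEff (w k)) * (weightedCDF (w k) ρ (s k) - cdf P (s k))) t) atTop
      (𝓝 (Real.exp (-(t ^ 2 * (q * (1 - q)) / 2)) : ℂ)) := by
  have hmeas (k : ℕ) : Measurable fun x => (Set.Iic (s k)).indicator (1 : ℝ → ℝ) x - cdf P (s k) :=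
    (measurable_indicator_Iic _).sub_const _
  simp only [scaled_weightedCDF_sub_eq_sum (hw _)]
  refine tendsto_charFun_map_sum (fun k i => ?_) (fun k => iIndepFun_mul_eval _ (hmeas k))
    (fun ε hε => ?_) (fun k i => ?_) ?_ t
  · exact (((hmeas k).comp (measurable_pi_apply i)).const_mul _).aemeasurable
  · filter_upwards [hmax ε hε] with k hk i
    refine ae_of_all _ fun ρ => ?_
    have ha : 0 ≤ √(nEff (w k)) * normWeight (w k) i :=
      mul_nonneg (Real.sqrt_nonneg _) (normWeight_pos (hw k) i).le
    rw [abs_mul, abs_of_nonneg ha]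
    exact (mul_le_of_le_one_right ha
      (abs_indicator_one_sub_le _ (cdf_nonneg P _) (cdf_le_one P _) _)).trans (hk i)
  · rw [integral_const_mul, integral_comp_eval (μ := fun _ => P)
      (f := fun x => (Set.Iic (s k)).indicator 1 x - cdf P (s k)) (hmeas k).aestronglyMeasurable,
      integral_sub ((memLp_indicator_Iic (s k) 1).integrable le_rfl) (integrable_const _),
      integral_indicator_Iic]
    simp
  · refine Tendsto.congr (fun k => ?_) (hs.mul (hs.const_sub 1))
    refine ((sum_variance_mul_eval _ (hmeas k)).trans ?_).symm
    rw [sum_scaled_normWeight_sq (hw k), one_mul, variance_sub_const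
      (measurable_indicator_Iic _).aestronglyMeasurable, variance_indicator_one measurableSet_Iic,
      cdf_eq_real]

lemma tendsto_real_le_weightedCDF (hw : ∀ k i, 0 < w k i)
    (hmax : ∀ ε > 0, ∀ᶠ k in atTop, ∀ i, √(nEff (w k)) * normWeight (w k) i ≤ ε)
    (hq0 : 0 < q) (hq1 : q < 1) (hs : Tendsto (fun k => cdf P (s k)) atTop (𝓝 q))
    (hd : Tendsto (fun k => √(nEff (w k)) * (cdf P (s k) - q)) atTop (𝓝 d)) :
    Tendsto (fun k => (sampling (m k) P).real {ρ | q ≤ weightedCDF (w k) ρ (s k)}) atTop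
      (𝓝 ((gaussianReal d (q * (1 - q)).toNNReal).real (Set.Ici 0))) := by
  have hv : 0 < q * (1 - q) := mul_pos hq0 (sub_pos.2 hq1)
  let Z (k : ℕ) (ρ : Fin (m k) → ℝ) := √(nEff (w k)) * (weightedCDF (w k) ρ (s k) - cdf P (s k))
  let δ (k : ℕ) := √(nEff (w k)) * (cdf P (s k) - q)
  have hZ (k : ℕ) : Measurable (Z k) := by fun_prop
  have hset (k : ℕ) : (sampling (m k) P).real {ρ | q ≤ weightedCDF (w k) ρ (s k)}
      = (((sampling (m k) P).map (Z k)).map (· + δ k)).real (Set.Ici 0) := by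
    rw [map_measureReal_apply (by fun_prop) measurableSet_Ici,
      map_measureReal_apply (hZ k) (measurableSet_Ici.preimage (by fun_prop))]
    congr 1
    ext ρ
    simp only [Set.mem_ofPred_eq, Set.mem_preimage, Set.mem_Ici, Z, δ, ← mul_add,
      sub_add_sub_cancel, mul_nonneg_iff_of_pos_left (Real.sqrt_pos.2 (nEff_pos (hw k))),
      sub_nonneg]
  have hprob (k : ℕ) : IsProbabilityMeasure ((sampling (m k) P).map (Z k)) :=
    Measure.isProbabilityMeasure_map (hZ k).aemeasurable
  have hprob' (k : ℕ) : IsProbabilityMeasure (((sampling (m k) P).map (Z k)).map (· + δ k)) :=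
    Measure.isProbabilityMeasure_map (by fun_prop)
  simp only [hset]
  refine tendsto_real_of_tendsto_charFun (fun t => ?_)
    (gaussianReal_frontier_Ici (Real.toNNReal_pos.2 hv).ne' _ _)
  have hgauss : charFun (gaussianReal d (q * (1 - q)).toNNReal) t
      = (Real.exp (-(t ^ 2 * (q * (1 - q)) / 2)) : ℂ) * Complex.exp (t * d * Complex.I) := by
    rw [charFun_gaussianReal, Complex.ofReal_exp, ← Complex.exp_add, Real.coe_toNNReal _ hv.le]
    congr 1
    push_cast
    ring
  simp only [charFun_map_add_const, hgauss]
  refine (tendsto_charFun_map_scaled_weightedCDF hw hmax hs t).mul ?_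
  refine (Continuous.tendsto' (f := fun x : ℝ => Complex.exp ((inner ℝ x t : ℝ) * Complex.I))
    (by fun_prop) d _ ?_).comp hd
  rw [Real.inner_apply, Complex.ofReal_mul, mul_comm (d : ℂ)]

end WeightedEmpirical

section HighProb

variable {Ω : ℕ → Type*} [∀ k, MeasurableSpace (Ω k)] {μ : ∀ k, Measure (Ω k)}

/-- The filter of events `S` whose probability under the `k`-th law tends to `1`, encoded on the
disjoint union of the sample spaces by `μ k Sᶜ → 0`. Convergence in probability to a constant is
convergence along this filter. -/
def highProb (μ : ∀ k, Measure (Ω k)) : Filter (Σ k, Ω k) where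
  sets := {S | Tendsto (fun k => μ k {ω | ⟨k, ω⟩ ∉ S}) atTop (𝓝 0)}
  univ_sets := by simp
  sets_of_superset hS hST := tendsto_of_tendsto_of_tendsto_of_le_of_le tendsto_const_nhds hS
    (fun _ => zero_le) fun _ => measure_mono fun _ hω h => hω (hST h)
  inter_sets {S T} hS hT := by
    refine tendsto_of_tendsto_of_tendsto_of_le_of_le tendsto_const_nhds
      (by simpa only [add_zero] using hS.add hT) (fun _ => zero_le) fun k => ?_
    refine (measure_mono fun ω hω => ?_).trans (measure_union_le _ _)
    exact not_and_or.1 hω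

lemma eventually_highProb {p : (Σ k, Ω k) → Prop} :
    (∀ᶠ s in highProb μ, p s) ↔ Tendsto (fun k => μ k {ω | ¬ p ⟨k, ω⟩}) atTop (𝓝 0) :=
  Iff.rfl

lemma tendsto_nhds_highProb {X : (Σ k, Ω k) → ℝ} {a : ℝ} :
    Tendsto X (highProb μ) (𝓝 a) ↔
      ∀ ε > 0, Tendsto (fun k => μ k {ω | ε ≤ |X ⟨k, ω⟩ - a|}) atTop (𝓝 0) := by
  simp only [Metric.tendsto_nhds, Real.dist_eq, eventually_highProb, not_lt]

lemma tendsto_fst_highProb : Tendsto Sigma.fst (highProb μ) atTop := by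
  refine tendsto_atTop.2 fun N => eventually_highProb.2 (tendsto_const_nhds.congr' ?_)
  filter_upwards [eventually_ge_atTop N] with k hk
  simp [hk]

lemma tendstoInProb_iff {m : ℕ → ℕ} {P : Measure ℝ} {X : ∀ k, (Fin (m k) → ℝ) → ℝ} {a : ℝ} :
    TendstoInProb m P X a ↔
      Tendsto (fun s : Σ k, Fin (m k) → ℝ => X s.1 s.2) (highProb fun k => sampling (m k) P)
        (𝓝 a) :=
  (tendsto_nhds_highProb (μ := fun k => sampling (m k) P) (X := fun s => X s.1 s.2)).symm

variable [∀ k, IsProbabilityMeasure (μ k)]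

lemma tendsto_highProb_of_variance {X : ∀ k, Ω k → ℝ} {a : ℝ} (hX : ∀ k, MemLp (X k) 2 (μ k))
    (hmean : Tendsto (fun k => ∫ ω, X k ω ∂(μ k)) atTop (𝓝 a))
    (hvar : Tendsto (fun k => variance (X k) (μ k)) atTop (𝓝 0)) :
    Tendsto (fun s : Σ k, Ω k => X s.1 s.2) (highProb μ) (𝓝 a) := by
  refine tendsto_nhds_highProb.2 fun ε hε => ?_
  have hbound : Tendsto (fun k => ENNReal.ofReal (variance (X k) (μ k) / (ε / 2) ^ 2)) atTop
      (𝓝 0) := by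
    simpa using ENNReal.tendsto_ofReal (hvar.div_const ((ε / 2) ^ 2))
  refine tendsto_of_tendsto_of_tendsto_of_le_of_le' tendsto_const_nhds hbound
    (.of_forall fun _ => zero_le) ?_
  filter_upwards [Metric.tendsto_nhds.1 hmean (ε / 2) (half_pos hε)] with k hk
  refine (measure_mono fun ω hω => ?_).trans (meas_ge_le_variance_div_sq (hX k) (half_pos hε))
  have htri := (hω : ε ≤ _).trans (abs_sub_le (X k ω) (∫ ω, X k ω ∂(μ k)) a)
  rw [Real.dist_eq] at hk
  exact (by linarith : ε / 2 ≤ |X k ω - ∫ ω, X k ω ∂(μ k)|)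

lemma eventually_highProb_of_tight {Z : (Σ k, Ω k) → ℝ} {p : (Σ k, Ω k) → Prop}
    (hZ : ∀ η > 0, ∃ R : ℝ, ∀ k, (μ k).real {ω | R < |Z ⟨k, ω⟩|} ≤ η)
    (hp : ∀ R : ℝ, ∀ᶠ s in highProb μ, |Z s| ≤ R → p s) : ∀ᶠ s in highProb μ, p s := by
  refine eventually_highProb.2 (ENNReal.tendsto_nhds_zero.2 fun η hη => ?_)
  obtain ⟨δ, hδ, hδη⟩ := ENNReal.lt_iff_exists_nnreal_btwn.1 hη
  obtain ⟨R, hR⟩ := hZ (δ / 2) (half_pos (by exact_mod_cast hδ))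
  filter_upwards [ENNReal.tendsto_nhds_zero.1 (eventually_highProb.1 (hp R)) (δ / 2)
    (ENNReal.half_pos hδ.ne')] with k hk
  calc μ k {ω | ¬ p ⟨k, ω⟩}
      ≤ μ k ({ω | R < |Z ⟨k, ω⟩|} ∪ {ω | ¬ (|Z ⟨k, ω⟩| ≤ R → p ⟨k, ω⟩)}) :=
        measure_mono fun ω hω => (lt_or_ge R |Z ⟨k, ω⟩|).imp_right fun hle h => hω (h hle)
    _ ≤ δ / 2 + δ / 2 := (measure_union_le _ _).trans (add_le_add ?_ hk)
    _ ≤ η := (ENNReal.add_halves _).trans_le hδη.le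
  rw [← ofReal_measureReal]
  refine (ENNReal.ofReal_le_ofReal (hR k)).trans_eq ?_
  rw [ENNReal.ofReal_div_of_pos two_pos, ENNReal.ofReal_coe_nnreal, ENNReal.ofReal_ofNat]

end HighProb

section Monotone

lemma tendstoLocallyUniformly_of_monotone {α β : Type*} [LinearOrder β] [TopologicalSpace β]
    [OrderTopology β] {l : Filter α} {H : α → β → ℝ} {h : β → ℝ} (hH : ∀ a, Monotone (H a))
    (hh : Continuous h) (hlim : ∀ y, Tendsto (H · y) l (𝓝 (h y))) :
    TendstoLocallyUniformly H h l := by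
  refine Metric.tendstoLocallyUniformly_iff.2 fun ε hε x => ?_
  obtain ⟨b, c, hx, hbc, hsub⟩ := exists_Icc_mem_subset_of_mem_nhds
    (hh.continuousAt.preimage_mem_nhds (Metric.ball_mem_nhds (h x) (by positivity : 0 < ε / 4)))
  have hb_le_c : b ≤ c := hx.1.trans hx.2
  refine ⟨_, hbc, ?_⟩
  filter_upwards [Metric.tendsto_nhds.1 (hlim b) (ε / 4) (by positivity),
    Metric.tendsto_nhds.1 (hlim c) (ε / 4) (by positivity)] with a hb hc y hy
  have hhb := hsub (Set.left_mem_Icc.2 hb_le_c)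
  have hhc := hsub (Set.right_mem_Icc.2 hb_le_c)
  have hhy := hsub hy
  have hHb := hH a hy.1
  have hHc := hH a hy.2
  simp only [Set.mem_preimage, Metric.mem_ball, Real.dist_eq, abs_lt] at hhb hhc hhy hb hc ⊢
  constructor <;> linarith

lemma abs_mul_add_le_of_le_iff {H : ℝ → ℝ} {f ε M R X : ℝ} (hf : 0 < f)
    (hε : 0 ≤ ε) (hX : ∀ y, X ≤ y ↔ 0 ≤ H y) (hH0 : |H 0| ≤ R) (hM : R + ε ≤ f * M)
    (hH : ∀ y ∈ Set.Icc (-M) M, |H y - H 0 - f * y| < ε) : |f * X + H 0| ≤ ε := by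
  have hmem : ∀ z, |z| ≤ R + ε → z / f ∈ Set.Icc (-M) M := fun z hz => by
    refine abs_le.1 ?_
    rw [abs_div, abs_of_pos hf, div_le_iff₀' hf]
    exact hz.trans hM
  rw [abs_le] at hH0
  have hupper := (abs_lt.1 (hH _ (hmem (ε - H 0) (abs_le.2 ⟨by linarith, by linarith⟩)))).1
  have hlower := (abs_lt.1 (hH _ (hmem (-ε - H 0) (abs_le.2 ⟨by linarith, by linarith⟩)))).2
  rw [mul_div_cancel₀ _ hf.ne'] at hupper hlower
  have hX_le : X ≤ (ε - H 0) / f := (hX _).2 (by linarith)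
  have hX_gt : (-ε - H 0) / f < X := lt_of_not_ge fun h => absurd ((hX _).1 h) (by linarith)
  rw [le_div_iff₀' hf] at hX_le
  rw [div_lt_iff₀' hf] at hX_gt
  exact abs_le.2 ⟨by linarith, by linarith⟩

end Monotone

section Local

variable {n : ℕ} {w ρ : Fin n → ℝ} {q θ x y : ℝ}

/-- The weighted empirical distribution function in the local coordinate `y = √n_eff * (t - θ)`,
centred at the level `q` and scaled by `√n_eff`. -/
noncomputable def localDeviation (w : Fin n → ℝ) (q θ : ℝ) (ρ : Fin n → ℝ) (y : ℝ) : ℝ :=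
  √(nEff w) * (weightedCDF w ρ (θ + y / √(nEff w)) - q)

@[fun_prop]
lemma measurable_localDeviation (w : Fin n → ℝ) (q θ y : ℝ) :
    Measurable fun ρ => localDeviation w q θ ρ y := by
  unfold localDeviation
  fun_prop

lemma localDeviation_zero (w : Fin n → ℝ) (q θ : ℝ) (ρ : Fin n → ℝ) :
    localDeviation w q θ ρ 0 = √(nEff w) * (weightedCDF w ρ θ - q) := by
  rw [localDeviation, zero_div, add_zero]

variable [NeZero n]

lemma monotone_localDeviation (hw : ∀ i, 0 < w i) (q θ : ℝ) (ρ : Fin n → ℝ) :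
    Monotone (localDeviation w q θ ρ) := fun y z hyz =>
  mul_le_mul_of_nonneg_left (sub_le_sub_right (weightedCDF_mono hw ρ (by gcongr)) _)
    (Real.sqrt_nonneg _)

lemma freqError_le_iff_wcpThreshold_le (hw : ∀ i, 0 < w i) :
    freqError w q θ ρ ≤ y ↔ wcpThreshold w ρ q ≤ θ + y / √(nEff w) := by
  rw [freqError, ← le_div_iff₀' (Real.sqrt_pos.2 (nEff_pos hw)), sub_le_iff_le_add']

lemma freqError_le_iff (hw : ∀ i, 0 < w i) (hq0 : 0 < q) (hq1 : q ≤ 1) :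
    freqError w q θ ρ ≤ y ↔ 0 ≤ localDeviation w q θ ρ y := by
  rw [freqError_le_iff_wcpThreshold_le hw, wcpThreshold_le_iff hw ρ hq0 hq1, localDeviation,
    mul_nonneg_iff_of_pos_left (Real.sqrt_pos.2 (nEff_pos hw)), sub_nonneg]

lemma measurable_freqError (hw : ∀ i, 0 < w i) (hq0 : 0 < q) (hq1 : q ≤ 1) :
    Measurable (freqError w q θ) := by
  refine measurable_of_Iic fun y => ?_
  simp only [Set.preimage, Set.mem_Iic, freqError_le_iff hw hq0 hq1]
  exact measurableSet_le measurable_const (measurable_localDeviation w q θ y)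

lemma localDeviation_freqError_add (hw : ∀ i, 0 < w i) :
    localDeviation w q θ ρ (freqError w q θ ρ + x)
      = √(nEff w) * (weightedCDF w ρ (wcpThreshold w ρ q + x / √(nEff w)) - q) := by
  have := (Real.sqrt_pos.2 (nEff_pos hw)).ne'
  rw [localDeviation, freqError]
  congr 3
  field_simp
  ring

end Local

section LocalMoments

variable {n : ℕ} {w : Fin n → ℝ} {P : Measure ℝ} [IsProbabilityMeasure P] {θ : ℝ}

lemma memLp_localDeviation (w : Fin n → ℝ) (q θ y : ℝ) (p : ENNReal) :
    MemLp (fun ρ => localDeviation w q θ ρ y) p (sampling n P) :=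
  ((memLp_weightedCDF w _ p).sub (memLp_const q)).const_mul _

variable [NeZero n]

lemma integral_localDeviation_zero (hw : ∀ i, 0 < w i) :
    ∫ ρ, localDeviation w (cdf P θ) θ ρ 0 ∂(sampling n P) = 0 := by
  simp only [localDeviation_zero]
  rw [integral_const_mul, integral_sub ((memLp_weightedCDF w θ 1).integrable le_rfl)
    (integrable_const _), integral_weightedCDF hw]
  simp

lemma integral_localDeviation_zero_sq (hw : ∀ i, 0 < w i) :
    ∫ ρ, localDeviation w (cdf P θ) θ ρ 0 ^ 2 ∂(sampling n P) = cdf P θ * (1 - cdf P θ) := by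
  rw [← variance_of_integral_eq_zero (measurable_localDeviation w _ θ 0).aemeasurable
    (integral_localDeviation_zero hw)]
  simp only [localDeviation_zero]
  rw [variance_const_mul, variance_sub_const (by fun_prop), ← freqVar, freqVar_eq,
    Real.sq_sqrt (nEff_pos hw).le, mul_div_cancel₀ _ (nEff_pos hw).ne']

lemma integral_localDeviation_zero_pow_four_le (hw : ∀ i, 0 < w i) :
    ∫ ρ, localDeviation w (cdf P θ) θ ρ 0 ^ 4 ∂(sampling n P) ≤ 48 * Real.exp (1 / 8) := by
  simp only [localDeviation_zero]
  convert integral_pow_four_le (hasSubgaussianMGF_scaled_weightedCDF_sub_cdf (P := P) hw θ) using 3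
  norm_num

lemma exists_sampling_real_lt_abs_localDeviation_zero_le {η : ℝ} (hη : 0 < η) :
    ∃ R : ℝ, ∀ (n : ℕ) [NeZero n] (w : Fin n → ℝ), (∀ i, 0 < w i) →
      (sampling n P).real {ρ | R < |localDeviation w (cdf P θ) θ ρ 0|} ≤ η := by
  have hR : 0 < √(1 / η) := by positivity
  refine ⟨√(1 / η), fun n _ w hw => ?_⟩
  have hcheb := meas_ge_le_variance_div_sq (memLp_localDeviation w (cdf P θ) θ 0 2 (P := P)) hR
  rw [variance_of_integral_eq_zero (measurable_localDeviation w _ θ 0).aemeasurable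
    (integral_localDeviation_zero hw), integral_localDeviation_zero_sq hw,
    integral_localDeviation_zero hw, Real.sq_sqrt (by positivity)] at hcheb
  simp only [sub_zero] at hcheb
  refine (measureReal_mono (Set.ofPred_subset_ofPred.2 fun ρ => le_of_lt)).trans
    ((ENNReal.toReal_le_of_le_ofReal ?_ hcheb).trans ?_)
  · have := sub_nonneg.2 (cdf_le_one P θ)
    have := cdf_nonneg P θ
    positivity
  · rw [div_div_eq_mul_div, div_one]
    exact mul_le_of_le_one_left hη.le (by nlinarith [sq_nonneg (cdf P θ - 1), cdf_nonneg P θ])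

end LocalMoments

section LocalAsymptotics

variable {P : Measure ℝ} {m : ℕ → ℕ} {w : ∀ k, Fin (m k) → ℝ} {θ f : ℝ}

lemma tendsto_cdf_add_div_sqrt_nEff (hneff : Tendsto (fun k => nEff (w k)) atTop atTop)
    (hF : ContinuousAt (cdf P) θ) (y : ℝ) :
    Tendsto (fun k => cdf P (θ + y / √(nEff (w k)))) atTop (𝓝 (cdf P θ)) := by
  refine hF.tendsto.comp ?_
  simpa using ((Real.tendsto_sqrt_atTop.comp hneff).const_div_atTop y).const_add θ

lemma tendsto_sqrt_nEff_mul_cdf_sub (hneff : Tendsto (fun k => nEff (w k)) atTop atTop)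
    (hF : HasDerivAt (cdf P) f θ) (y : ℝ) :
    Tendsto (fun k => √(nEff (w k)) * (cdf P (θ + y / √(nEff (w k))) - cdf P θ)) atTop
      (𝓝 (f * y)) := by
  have h := hF.hasFDerivAt.lim y
    (tendsto_norm_atTop_atTop.comp (Real.tendsto_sqrt_atTop.comp hneff))
  simpa [div_eq_inv_mul, mul_comm f] using h

variable [IsProbabilityMeasure P] [∀ k, NeZero (m k)]

lemma tendsto_localDeviation_sub (hw : ∀ k i, 0 < w k i)
    (hneff : Tendsto (fun k => nEff (w k)) atTop atTop) (hF : HasDerivAt (cdf P) f θ) (q y : ℝ) :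
    Tendsto (fun s : Σ k, Fin (m k) → ℝ =>
        localDeviation (w s.1) q θ s.2 y - localDeviation (w s.1) q θ s.2 0)
      (highProb fun k => sampling (m k) P) (𝓝 (f * y)) := by
  have hsub (k : ℕ) (ρ : Fin (m k) → ℝ) : localDeviation (w k) q θ ρ y
      - localDeviation (w k) q θ ρ 0
      = √(nEff (w k)) * (weightedCDF (w k) ρ (θ + y / √(nEff (w k))) - weightedCDF (w k) ρ θ) := by
    rw [localDeviation_zero, localDeviation]
    ring
  refine tendsto_highProb_of_variance (μ := fun k => sampling (m k) P)
    (X := fun k ρ => localDeviation (w k) q θ ρ y - localDeviation (w k) q θ ρ 0)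
    (fun k => (memLp_localDeviation _ q θ y 2).sub (memLp_localDeviation _ q θ 0 2)) ?_ ?_
  · refine (tendsto_sqrt_nEff_mul_cdf_sub hneff hF y).congr fun k => ?_
    simp only [hsub]
    rw [integral_const_mul, integral_sub ((memLp_weightedCDF _ _ 1).integrable le_rfl)
      ((memLp_weightedCDF _ _ 1).integrable le_rfl), integral_weightedCDF (hw k),
      integral_weightedCDF (hw k)]
  · have hcdf := ((tendsto_cdf_add_div_sqrt_nEff hneff hF.continuousAt y).sub_const (cdf P θ)).abs
    rw [sub_self, abs_zero] at hcdf
    refine squeeze_zero (fun _ => variance_nonneg _ _) (fun k => ?_) hcdf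
    simp only [hsub]
    rw [variance_const_mul, Real.sq_sqrt (nEff_pos (hw k)).le]
    exact (mul_le_mul_of_nonneg_left (variance_weightedCDF_sub_le _ _ _)
      (nEff_pos (hw k)).le).trans_eq (mul_div_cancel₀ _ (nEff_pos (hw k)).ne')

lemma eventually_abs_localDeviation_sub_lt (hw : ∀ k i, 0 < w k i)
    (hneff : Tendsto (fun k => nEff (w k)) atTop atTop) (hF : HasDerivAt (cdf P) f θ) (q M : ℝ)
    {ε : ℝ} (hε : 0 < ε) :
    ∀ᶠ s : Σ k, Fin (m k) → ℝ in highProb fun k => sampling (m k) P, ∀ y ∈ Set.Icc (-M) M,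
      |localDeviation (w s.1) q θ s.2 y - localDeviation (w s.1) q θ s.2 0 - f * y| < ε := by
  have hunif := tendstoLocallyUniformly_of_monotone
    (fun (s : Σ k, Fin (m k) → ℝ) _ _ hyz => sub_le_sub_right
      (monotone_localDeviation (hw s.1) q θ s.2 hyz) (localDeviation (w s.1) q θ s.2 0))
    (continuous_const_mul f) (tendsto_localDeviation_sub hw hneff hF q)
  have hunifOn := (tendstoLocallyUniformlyOn_iff_tendstoUniformlyOn_of_compact isCompact_Icc).1
    (hunif.tendstoLocallyUniformlyOn (s := Set.Icc (-M) M))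
  filter_upwards [Metric.tendstoUniformlyOn_iff.1 hunifOn ε hε] with s hs y hy
  rw [← Real.dist_eq, dist_comm]
  exact hs y hy

lemma eventually_highProb_of_abs_localDeviation_zero_le (hw : ∀ k i, 0 < w k i)
    {p : (Σ k, Fin (m k) → ℝ) → Prop}
    (hp : ∀ R : ℝ, ∀ᶠ s : Σ k, Fin (m k) → ℝ in highProb fun k => sampling (m k) P,
      |localDeviation (w s.1) (cdf P θ) θ s.2 0| ≤ R → p s) :
    ∀ᶠ s in highProb fun k => sampling (m k) P, p s := by
  refine eventually_highProb_of_tight (fun η hη => ?_) hp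
  obtain ⟨R, hR⟩ := exists_sampling_real_lt_abs_localDeviation_zero_le (P := P) (θ := θ) hη
  exact ⟨R, fun k => hR (m k) (w k) (hw k)⟩

lemma tendsto_mul_freqError_add_localDeviation_zero (hw : ∀ k i, 0 < w k i)
    (hneff : Tendsto (fun k => nEff (w k)) atTop atTop) (hθ0 : 0 < cdf P θ)
    (hf : 0 < f) (hF : HasDerivAt (cdf P) f θ) :
    Tendsto (fun s : Σ k, Fin (m k) → ℝ =>
        f * freqError (w s.1) (cdf P θ) θ s.2 + localDeviation (w s.1) (cdf P θ) θ s.2 0)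
      (highProb fun k => sampling (m k) P) (𝓝 0) := by
  refine Metric.tendsto_nhds.2 fun ε hε =>
    eventually_highProb_of_abs_localDeviation_zero_le (θ := θ) hw fun R => ?_
  filter_upwards [eventually_abs_localDeviation_sub_lt hw hneff hF (cdf P θ) ((R + ε / 2) / f)
    (half_pos hε)] with s hs hR
  rw [dist_zero_right]
  exact (abs_mul_add_le_of_le_iff hf (half_pos hε).le
    (fun y => freqError_le_iff (hw s.1) hθ0 (cdf_le_one P θ)) hR
    (mul_div_cancel₀ _ hf.ne').ge hs).trans_lt (half_lt_self hε)

lemma tendsto_scaled_weightedCDF_wcpThreshold_add (hw : ∀ k i, 0 < w k i)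
    (hneff : Tendsto (fun k => nEff (w k)) atTop atTop) (hθ0 : 0 < cdf P θ)
    (hf : 0 < f) (hF : HasDerivAt (cdf P) f θ) (x : ℝ) :
    Tendsto (fun s : Σ k, Fin (m k) → ℝ => √(nEff (w s.1)) * (weightedCDF (w s.1) s.2
        (wcpThreshold (w s.1) s.2 (cdf P θ) + x / √(nEff (w s.1))) - cdf P θ))
      (highProb fun k => sampling (m k) P) (𝓝 (f * x)) := by
  have hbahadur := tendsto_mul_freqError_add_localDeviation_zero hw hneff hθ0 hf hF
  simp only [← localDeviation_freqError_add (hw _) (θ := θ)]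
  refine Metric.tendsto_nhds.2 fun ε hε =>
    eventually_highProb_of_abs_localDeviation_zero_le (θ := θ) hw fun R => ?_
  filter_upwards [eventually_abs_localDeviation_sub_lt hw hneff hF (cdf P θ)
    ((R + ε / 2) / f + |x|) (half_pos hε), Metric.tendsto_nhds.1 hbahadur _ (half_pos hε)]
    with s hs hb hR
  set X := freqError (w s.1) (cdf P θ) θ s.2
  set L := localDeviation (w s.1) (cdf P θ) θ s.2
  rw [dist_zero_right, Real.norm_eq_abs] at hb
  have hfX : |X| ≤ (R + ε / 2) / f := by
    rw [le_div_iff₀' hf, ← abs_of_pos hf, ← abs_mul]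
    have htri := abs_sub (f * X + L 0) (L 0)
    rw [add_sub_cancel_right] at htri
    linarith
  have hmem : X + x ∈ Set.Icc (-((R + ε / 2) / f + |x|)) ((R + ε / 2) / f + |x|) :=
    abs_le.1 ((abs_add_le X x).trans (by gcongr))
  calc |L (X + x) - f * x| = |(L (X + x) - L 0 - f * (X + x)) + (f * X + L 0)| := by ring_nf
    _ ≤ _ := abs_add_le _ _
    _ < ε / 2 + ε / 2 := add_lt_add (hs _ hmem) hb
    _ = ε := add_halves ε

end LocalAsymptotics

section Truncation

variable {M : ℝ}

lemma abs_truncate_sub_self_le (hM : 1 ≤ M) (y : ℝ) :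
    |max (-M) (min M y) - y| ≤ y ^ 4 / M := by
  have hM0 : 0 < M := one_pos.trans_le hM
  have hle_of_lt : M < |y| → |y| ≤ y ^ 4 / M := fun hlt => by
    rw [le_div_iff₀ hM0, ← (by decide : Even 4).pow_abs]
    calc |y| * M ≤ |y| * |y| := by gcongr
      _ = |y| ^ 2 := (sq _).symm
      _ ≤ |y| ^ 4 := pow_le_pow_right₀ (hM.trans hlt.le) (by norm_num)
  rcases lt_or_ge y (-M) with hy | hy
  · refine le_trans ?_ (hle_of_lt (lt_abs.2 (.inr (by linarith))))
    rw [min_eq_right (by linarith), max_eq_left hy.le, abs_of_nonneg (by linarith),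
      abs_of_neg (by linarith)]
    linarith
  rcases lt_or_ge M y with hy' | hy'
  · refine le_trans ?_ (hle_of_lt (lt_abs.2 (.inl hy')))
    rw [min_eq_left hy'.le, max_eq_right (by linarith), abs_of_neg (by linarith),
      abs_of_pos (by linarith)]
    linarith
  · rw [min_eq_right hy', max_eq_right hy, sub_self, abs_zero]
    positivity

lemma abs_min_sq_sub_sq_le (hM : 1 ≤ M) (y : ℝ) : |min (M ^ 2) (y ^ 2) - y ^ 2| ≤ y ^ 4 / M := by
  have hM0 : 0 < M := one_pos.trans_le hM
  rcases le_total (M ^ 2) (y ^ 2) with h | h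
  · rw [min_eq_left h, abs_sub_comm, abs_of_nonneg (sub_nonneg.2 h), le_div_iff₀ hM0]
    calc (y ^ 2 - M ^ 2) * M ≤ y ^ 2 * M ^ 2 := by
          gcongr
          exacts [sub_le_self _ (sq_nonneg M), le_self_pow₀ hM two_ne_zero]
      _ ≤ y ^ 2 * y ^ 2 := by gcongr
      _ = y ^ 4 := by ring
  · rw [min_eq_right h, sub_self, abs_zero]
    positivity

lemma uniformContinuous_min_sq (M : ℝ) : UniformContinuous fun x : ℝ => min (M ^ 2) (x ^ 2) := by
  refine Continuous.uniformContinuous_of_tendsto_cocompact (x := M ^ 2) (by fun_prop)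
    (tendsto_const_nhds.congr' ?_)
  filter_upwards [tendsto_norm_cocompact_atTop.eventually_ge_atTop |M|] with x hx
  exact (min_eq_left (sq_le_sq.2 hx)).symm

end Truncation

section Integral

lemma abs_integral_comp_sub_integral_le {Ω : Type*} [MeasurableSpace Ω] {μ : Measure Ω} {Y : Ω → ℝ}
    {φ ψ : ℝ → ℝ} {A M : ℝ} (hM : 0 ≤ M) (hφ : Integrable (fun ω => φ (Y ω)) μ)
    (hψ : Integrable (fun ω => ψ (Y ω)) μ) (h4 : Integrable (fun ω => Y ω ^ 4) μ)
    (hA : ∫ ω, Y ω ^ 4 ∂μ ≤ A) (hφψ : ∀ y, |φ y - ψ y| ≤ y ^ 4 / M) :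
    |∫ ω, φ (Y ω) ∂μ - ∫ ω, ψ (Y ω) ∂μ| ≤ A / M := by
  rw [← integral_sub hφ hψ]
  calc |∫ ω, (φ (Y ω) - ψ (Y ω)) ∂μ| ≤ ∫ ω, |φ (Y ω) - ψ (Y ω)| ∂μ := abs_integral_le_integral_abs
    _ ≤ ∫ ω, Y ω ^ 4 / M ∂μ :=
        integral_mono (hφ.sub hψ).abs (h4.div_const M) fun ω => hφψ (Y ω)
    _ ≤ A / M := by
        rw [integral_div]
        gcongr

variable {Ω : ℕ → Type*} [∀ k, MeasurableSpace (Ω k)] {μ : ∀ k, Measure (Ω k)}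
  [∀ k, IsProbabilityMeasure (μ k)]

lemma tendsto_integral_zero_of_tendsto_highProb {Z : ∀ k, Ω k → ℝ} {K : ℝ}
    (hZ : ∀ k, Measurable (Z k)) (hK : ∀ k ω, |Z k ω| ≤ K)
    (hlim : Tendsto (fun s : Σ k, Ω k => Z s.1 s.2) (highProb μ) (𝓝 0)) :
    Tendsto (fun k => ∫ ω, Z k ω ∂(μ k)) atTop (𝓝 0) := by
  refine Metric.tendsto_nhds.2 fun ε hε => ?_
  have hprob := (ENNReal.tendsto_toReal ENNReal.zero_ne_top).comp
    (tendsto_nhds_highProb.1 hlim (ε / 2) (half_pos hε))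
  have hbound : Tendsto (fun k => ε / 2 + K * (μ k).real {ω | ε / 2 ≤ |Z k ω|}) atTop
      (𝓝 (ε / 2)) := by
    simpa [Function.comp_def, Measure.real] using (hprob.const_mul K).const_add (ε / 2)
  filter_upwards [hbound.eventually_lt_const (half_lt_self hε)] with k hk
  have hmeas : MeasurableSet {ω | ε / 2 ≤ |Z k ω|} :=
    measurableSet_le measurable_const (hZ k).abs
  have hindicator : Integrable ({ω | ε / 2 ≤ |Z k ω|}.indicator fun _ => K) (μ k) :=
    (integrable_const K).indicator hmeas
  rw [dist_zero_right]
  calc ‖∫ ω, Z k ω ∂(μ k)‖ ≤ ∫ ω, |Z k ω| ∂(μ k) := norm_integral_le_integral_norm _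
    _ ≤ ∫ ω, (ε / 2 + {ω | ε / 2 ≤ |Z k ω|}.indicator (fun _ => K) ω) ∂(μ k) := by
        refine integral_mono (.of_bound (hZ k).abs.aestronglyMeasurable K
          (.of_forall fun ω => by simpa using hK k ω)) ((integrable_const _).add hindicator)
          fun ω => ?_
        by_cases h : ω ∈ {ω | ε / 2 ≤ |Z k ω|}
        · rw [Set.indicator_of_mem h]
          exact (hK k ω).trans (le_add_of_nonneg_left (half_pos hε).le)
        · rw [Set.indicator_of_notMem h, add_zero]
          exact (not_le.1 h).le
    _ = ε / 2 + K * (μ k).real {ω | ε / 2 ≤ |Z k ω|} := by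
        rw [integral_add (integrable_const _) hindicator, integral_indicator_const _ hmeas]
        simp [mul_comm]
    _ < ε := hk

lemma tendsto_integral_comp_sub_of_tendsto_highProb {X Y : ∀ k, Ω k → ℝ} {φ : ℝ → ℝ} {K : ℝ}
    (hX : ∀ k, Measurable (X k)) (hY : ∀ k, Measurable (Y k)) (hφ : UniformContinuous φ)
    (hK : ∀ x, |φ x| ≤ K)
    (hXY : Tendsto (fun s : Σ k, Ω k => X s.1 s.2 - Y s.1 s.2) (highProb μ) (𝓝 0)) :
    Tendsto (fun k => ∫ ω, φ (X k ω) ∂(μ k) - ∫ ω, φ (Y k ω) ∂(μ k)) atTop (𝓝 0) := by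
  have hint {X : ∀ k, Ω k → ℝ} (hX : ∀ k, Measurable (X k)) (k : ℕ) :
      Integrable (fun ω => φ (X k ω)) (μ k) :=
    .of_bound (hφ.continuous.measurable.comp (hX k)).aestronglyMeasurable K
      (.of_forall fun ω => hK _)
  simp only [← integral_sub (hint hX _) (hint hY _)]
  refine tendsto_integral_zero_of_tendsto_highProb (K := K + K)
    (fun k => (hφ.continuous.measurable.comp (hX k)).sub
      (hφ.continuous.measurable.comp (hY k)))
    (fun k ω => (abs_sub _ _).trans (add_le_add (hK _) (hK _))) ?_
  refine Metric.tendsto_nhds.2 fun ε hε => ?_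
  obtain ⟨δ, hδ, hφδ⟩ := Metric.uniformContinuous_iff.1 hφ ε hε
  filter_upwards [Metric.tendsto_nhds.1 hXY δ hδ] with s hs
  rw [dist_zero_right, ← dist_eq_norm] at hs ⊢
  exact hφδ hs

lemma eventually_abs_integral_comp_sub_le {X Y : ∀ k, Ω k → ℝ} {φ ψ : ℝ → ℝ} {a A K M ε : ℝ}
    (hM : 0 ≤ M) (hAM : A / M < ε) (hX : ∀ k, Measurable (X k)) (hY : ∀ k, Measurable (Y k))
    (hφ : UniformContinuous φ) (hK : ∀ x, |φ x| ≤ K) (hφψ : ∀ y, |φ y - ψ y| ≤ y ^ 4 / M)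
    (hψ : ∀ k, Integrable (fun ω => ψ (Y k ω)) (μ k)) (ha : ∀ k, ∫ ω, ψ (Y k ω) ∂(μ k) = a)
    (h4 : ∀ k, Integrable (fun ω => Y k ω ^ 4) (μ k)) (hA : ∀ k, ∫ ω, Y k ω ^ 4 ∂(μ k) ≤ A)
    (hXY : Tendsto (fun s : Σ k, Ω k => X s.1 s.2 - Y s.1 s.2) (highProb μ) (𝓝 0)) :
    ∀ᶠ k in atTop, |∫ ω, φ (X k ω) ∂(μ k) - a| ≤ ε := by
  filter_upwards [Metric.tendsto_nhds.1
    (tendsto_integral_comp_sub_of_tendsto_highProb hX hY hφ hK hXY) _ (sub_pos.2 hAM)] with k hk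
  have hφY : Integrable (fun ω => φ (Y k ω)) (μ k) :=
    .of_bound (hφ.continuous.measurable.comp (hY k)).aestronglyMeasurable K
      (.of_forall fun ω => hK _)
  have hYM := abs_integral_comp_sub_integral_le hM hφY (hψ k) (h4 k) (hA k) hφψ
  rw [ha] at hYM
  rw [dist_zero_right, Real.norm_eq_abs] at hk
  exact (abs_sub_le _ _ _).trans ((add_le_add hk.le hYM).trans_eq (sub_add_cancel _ _))

end Integral

lemma hasAsymptoticVariance_of_tendsto_highProb {m : ℕ → ℕ} {P : Measure ℝ}
    [IsProbabilityMeasure P] {X Y : ∀ k, (Fin (m k) → ℝ) → ℝ} {v A : ℝ}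
    (hX : ∀ k, Measurable (X k)) (hY : ∀ k, Measurable (Y k))
    (hY4 : ∀ k, MemLp (Y k) 4 (sampling (m k) P))
    (hmean : ∀ k, ∫ ρ, Y k ρ ∂(sampling (m k) P) = 0)
    (hsq : ∀ k, ∫ ρ, Y k ρ ^ 2 ∂(sampling (m k) P) = v)
    (hA : ∀ k, ∫ ρ, Y k ρ ^ 4 ∂(sampling (m k) P) ≤ A)
    (hXY : Tendsto (fun s : Σ k, Fin (m k) → ℝ => X s.1 s.2 - Y s.1 s.2)
      (highProb fun k => sampling (m k) P) (𝓝 0)) : HasAsymptoticVariance m P X v := by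
  intro ε hε
  obtain ⟨M₀, hM₀⟩ := eventually_atTop.1 <|
    (tendsto_id.const_div_atTop A).eventually_lt_const hε
  refine ⟨max 1 M₀, fun M hM => ?_⟩
  have hM1 : 1 ≤ M := (le_max_left _ _).trans hM
  have hM0 : 0 ≤ M := zero_le_one.trans hM1
  have hAM : A / M < ε := hM₀ M ((le_max_right _ _).trans hM)
  have h4 (k : ℕ) : Integrable (fun ρ => Y k ρ ^ 4) (sampling (m k) P) := by
    simpa [(by decide : Even 4).pow_abs] using (hY4 k).integrable_norm_pow (p := 4) (by norm_num)
  have htrunc := eventually_abs_integral_comp_sub_le (μ := fun k => sampling (m k) P)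
    (φ := fun x => max (-M) (min M x)) (ψ := fun x => x) hM0 hAM hX hY
    ((LipschitzWith.id.const_min M).const_max (-M)).uniformContinuous
    (fun x => abs_le.2 ⟨le_max_left _ _, max_le (by linarith) (min_le_left _ _)⟩)
    (abs_truncate_sub_self_le hM1) (fun k => (hY4 k).integrable (by norm_num)) hmean h4 hA hXY
  have hsqtrunc := eventually_abs_integral_comp_sub_le (μ := fun k => sampling (m k) P)
    (φ := fun x => min (M ^ 2) (x ^ 2)) (ψ := fun x => x ^ 2) hM0 hAM hX hY
    (uniformContinuous_min_sq M)
    (fun x => (abs_of_nonneg (le_min (sq_nonneg _) (sq_nonneg _))).trans_le (min_le_left _ _))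
    (abs_min_sq_sub_sq_le hM1)
    (fun k => ((hY4 k).mono_exponent (by norm_num)).integrable_sq) hsq h4 hA hXY
  filter_upwards [htrunc, hsqtrunc] with k hk hksq
  exact ⟨by simpa only [sub_zero] using hk, hksq⟩

section SampleQuantile

variable {m : ℕ → ℕ} [∀ k, NeZero (m k)] {w : ∀ k, Fin (m k) → ℝ}
  {P : Measure ℝ} [IsProbabilityMeasure P] {θ f : ℝ}

lemma hasAsymptoticVariance_freqError (hw : ∀ k i, 0 < w k i)
    (hneff : Tendsto (fun k => nEff (w k)) atTop atTop) (hθ0 : 0 < cdf P θ)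
    (hf : 0 < f) (hF : HasDerivAt (cdf P) f θ) :
    HasAsymptoticVariance m P (fun k => freqError (w k) (cdf P θ) θ)
      (cdf P θ * (1 - cdf P θ) / f ^ 2) := by
  refine hasAsymptoticVariance_of_tendsto_highProb (A := 48 * Real.exp (1 / 8) / f ^ 4)
    (Y := fun k ρ => -f⁻¹ * localDeviation (w k) (cdf P θ) θ ρ 0)
    (fun k => measurable_freqError (hw k) hθ0 (cdf_le_one P θ)) (fun k => by fun_prop)
    (fun k => (memLp_localDeviation (w k) _ θ 0 4).const_mul _) (fun k => ?_) (fun k => ?_)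
    (fun k => ?_) ?_
  · rw [integral_const_mul, integral_localDeviation_zero (hw k), mul_zero]
  · simp only [mul_pow]
    rw [integral_const_mul, integral_localDeviation_zero_sq (hw k), div_eq_inv_mul, neg_sq, inv_pow]
  · simp only [mul_pow]
    rw [integral_const_mul, div_eq_inv_mul, (by decide : Even 4).neg_pow, inv_pow]
    gcongr
    exact integral_localDeviation_zero_pow_four_le (hw k)
  · have hlim := (tendsto_mul_freqError_add_localDeviation_zero hw hneff hθ0 hf hF).const_mul f⁻¹
    rw [mul_zero] at hlim
    refine hlim.congr fun s => ?_
    rw [mul_add, inv_mul_cancel_left₀ hf.ne', neg_mul, sub_neg_eq_add]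

lemma tendsto_sampling_real_freqError_le (hw : ∀ k i, 0 < w k i)
    (hmax : ∀ ε > 0, ∀ᶠ k in atTop, ∀ i, √(nEff (w k)) * normWeight (w k) i ≤ ε)
    (hneff : Tendsto (fun k => nEff (w k)) atTop atTop) (hθ0 : 0 < cdf P θ) (hθ1 : cdf P θ < 1)
    (hf : 0 < f) (hF : HasDerivAt (cdf P) f θ) (x : ℝ) :
    Tendsto (fun k => (sampling (m k) P).real {ρ | freqError (w k) (cdf P θ) θ ρ ≤ x}) atTop
      (𝓝 ((gaussianReal 0 (cdf P θ * (1 - cdf P θ) / f ^ 2).toNNReal).real (Set.Iic x))) := by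
  have hv : 0 ≤ cdf P θ * (1 - cdf P θ) := mul_nonneg hθ0.le (sub_nonneg.2 hθ1.le)
  rw [← gaussianReal_real_Ici x hf hv]
  simp only [freqError_le_iff_wcpThreshold_le (hw _), wcpThreshold_le_iff (hw _) _ hθ0 hθ1.le]
  exact tendsto_real_le_weightedCDF hw hmax hθ0 hθ1
    (tendsto_cdf_add_div_sqrt_nEff hneff hF.continuousAt x)
    (tendsto_sqrt_nEff_mul_cdf_sub hneff hF x)

end SampleQuantile

section VarianceCalibration

variable {n : ℕ} [NeZero n] {w : Fin n → ℝ} {P : Measure ℝ} [IsProbabilityMeasure P] {c t : ℝ}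
  {ρ : Fin n → ℝ} {j : Fin n}

lemma abs_freqVar_sub_le (hw : ∀ i, 0 < w i) (Q : Measure ℝ) :
    |freqVar w P t - cdf Q t * (1 - cdf Q t) / nEff w| ≤ |cdf P t - cdf Q t| / nEff w := by
  have hfactor : cdf P t * (1 - cdf P t) - cdf Q t * (1 - cdf Q t)
      = (cdf P t - cdf Q t) * (1 - cdf P t - cdf Q t) := by ring
  rw [freqVar_eq, ← sub_div, abs_div, abs_of_pos (nEff_pos hw), hfactor, abs_mul]
  refine div_le_div_of_nonneg_right ?_ (nEff_pos hw).le
  refine mul_le_of_le_one_right (abs_nonneg _) (abs_le.2 ⟨?_, ?_⟩)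
  · linarith [cdf_le_one P t, cdf_le_one Q t]
  · linarith [cdf_nonneg P t, cdf_nonneg Q t]

lemma postVar_eq_of_cumSum_eq (hw : ∀ i, 0 < w i) (hc : 0 < c)
    (hj : cumSum (sortedWeight ρ w) j = cdf P t) :
    postVar ρ w c j = freqVar w P t * nEff w / (c + 1) := by
  rw [postVar_eq hw hc, hj, freqVar_eq, div_mul_cancel₀ _ (nEff_pos hw).ne']

lemma freqVar_pos (hw : ∀ i, 0 < w i) (ht0 : 0 < cdf P t) (ht1 : cdf P t < 1) :
    0 < freqVar w P t := by
  rw [freqVar_eq]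
  exact div_pos (mul_pos ht0 (sub_pos.2 ht1)) (nEff_pos hw)

lemma postVar_eq_freqVar_iff (hw : ∀ i, 0 < w i) (hc : 0 < c) (ht0 : 0 < cdf P t)
    (ht1 : cdf P t < 1) (hj : cumSum (sortedWeight ρ w) j = cdf P t) :
    postVar ρ w c j = freqVar w P t ↔ c = nEff w - 1 := by
  rw [postVar_eq_of_cumSum_eq hw hc hj, div_eq_iff (by positivity),
    mul_right_inj' (freqVar_pos hw ht0 ht1).ne', eq_sub_iff_add_eq, eq_comm]

lemma postVar_lt_freqVar_iff (hw : ∀ i, 0 < w i) (hc : 0 < c) (ht0 : 0 < cdf P t)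
    (ht1 : cdf P t < 1) (hj : cumSum (sortedWeight ρ w) j = cdf P t) :
    postVar ρ w c j < freqVar w P t ↔ nEff w - 1 < c := by
  rw [postVar_eq_of_cumSum_eq hw hc hj, div_lt_iff₀ (by positivity),
    mul_lt_mul_iff_right₀ (freqVar_pos hw ht0 ht1), sub_lt_iff_lt_add]

lemma abs_postVar_nEff_sub_freqVar_le (hw : ∀ i, 0 < w i)
    (hj : cumSum (sortedWeight ρ w) j = cdf P t) :
    |postVar ρ w (nEff w) j - freqVar w P t| ≤ freqVar w P t / nEff w := by
  have hn := nEff_pos hw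
  have hv : 0 ≤ freqVar w P t := variance_nonneg _ _
  have hdiff : freqVar w P t * nEff w / (nEff w + 1) - freqVar w P t
      = -(freqVar w P t / (nEff w + 1)) := by
    field_simp
    ring
  rw [postVar_eq_of_cumSum_eq hw hn hj, hdiff, abs_neg, abs_of_nonneg (by positivity)]
  gcongr
  exact le_add_of_nonneg_right zero_le_one

end VarianceCalibration

section VarianceRatio

variable {m : ℕ → ℕ} [∀ k, NeZero (m k)] {w : ∀ k, Fin (m k) → ℝ} {q : ℝ}

lemma tendsto_cumSum_firstCrossing_sortedWeight (hw : ∀ k i, 0 < w k i)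
    (hneff : Tendsto (fun k => nEff (w k)) atTop atTop) (ρ : ∀ k, Fin (m k) → ℝ) (hq0 : 0 < q)
    (hq1 : q ≤ 1) :
    Tendsto (fun k => cumSum (sortedWeight (ρ k) (w k))
      (firstCrossing q (sortedWeight (ρ k) (w k)))) atTop (𝓝 q) := by
  have hbound := ((Real.tendsto_sqrt_atTop.comp hneff).const_div_atTop 1).const_add q
  rw [add_zero] at hbound
  refine tendsto_of_tendsto_of_tendsto_of_le_of_le tendsto_const_nhds hbound
    (fun k => ?_) fun k => ?_
  · exact le_cumSum_firstCrossing ((sortedWeight_mem_stdSimplex (hw k) (ρ k)).2.symm ▸ hq1)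
  · exact (cumSum_firstCrossing_lt hq0 _).le.trans
      (add_le_add_right (normWeight_le_one_div_sqrt_nEff (w k) _) q)

lemma tendsto_mul_inv_nhds_one_iff {ι : Type*} {l : Filter ι} {r y : ι → ℝ}
    (hr : Tendsto r l (𝓝 1)) : Tendsto (fun k => r k * (y k)⁻¹) l (𝓝 1) ↔ Tendsto y l (𝓝 1) := by
  constructor
  · intro h
    have hy := (h.div hr one_ne_zero).inv₀ (by norm_num)
    rw [div_one, inv_one] at hy
    refine hy.congr' ?_
    filter_upwards [hr.eventually_ne one_ne_zero] with k hk
    rw [Pi.div_apply, mul_div_cancel_left₀ _ hk, inv_inv]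
  · intro h
    simpa using hr.mul (h.inv₀ one_ne_zero)

lemma tendsto_postVar_div_freqVar_iff (hw : ∀ k i, 0 < w k i)
    (hneff : Tendsto (fun k => nEff (w k)) atTop atTop) {P : Measure ℝ} [IsProbabilityMeasure P]
    {θ : ℝ} (hθ0 : 0 < cdf P θ) (hθ1 : cdf P θ < 1) (ρ : ∀ k, Fin (m k) → ℝ) {c : ℕ → ℝ}
    (hc : ∀ k, 0 < c k) :
    Tendsto (fun k => postVar (ρ k) (w k) (c k)
          (firstCrossing (cdf P θ) (sortedWeight (ρ k) (w k))) / freqVar (w k) P θ) atTop (𝓝 1) ↔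
      Tendsto (fun k => c k / nEff (w k)) atTop (𝓝 1) := by
  set p := fun k => cumSum (sortedWeight (ρ k) (w k))
    (firstCrossing (cdf P θ) (sortedWeight (ρ k) (w k)))
  have hv : 0 < cdf P θ * (1 - cdf P θ) := mul_pos hθ0 (sub_pos.2 hθ1)
  have hp : Tendsto p atTop (𝓝 (cdf P θ)) :=
    tendsto_cumSum_firstCrossing_sortedWeight hw hneff ρ hθ0 hθ1.le
  have hratio : Tendsto (fun k => p k * (1 - p k) / (cdf P θ * (1 - cdf P θ))) atTop (𝓝 1) := by
    simpa only [div_self hv.ne'] using (hp.mul (hp.const_sub 1)).div_const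
      (cdf P θ * (1 - cdf P θ))
  have hinv : Tendsto (fun k => 1 / nEff (w k)) atTop (𝓝 0) := hneff.const_div_atTop 1
  have hvar (k : ℕ) : postVar (ρ k) (w k) (c k)
        (firstCrossing (cdf P θ) (sortedWeight (ρ k) (w k))) / freqVar (w k) P θ
      = p k * (1 - p k) / (cdf P θ * (1 - cdf P θ)) * ((c k + 1) / nEff (w k))⁻¹ := by
    rw [postVar_eq (hw k) (hc k), freqVar_eq, div_div_div_eq, inv_div, div_mul_div_comm,
      mul_comm (c k + 1)]
  simp only [hvar]
  rw [tendsto_mul_inv_nhds_one_iff hratio]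
  constructor <;> intro h
  · simpa [add_div] using h.sub hinv
  · simpa [add_div] using h.add hinv

end VarianceRatio

section PostError

variable {n : ℕ} [NeZero n] {w : Fin n → ℝ} {c q x : ℝ}

lemma postError_le_iff (hw : ∀ i, 0 < w i) {ρ v : Fin n → ℝ} :
    postError w ρ q v ≤ x ↔ postThreshold ρ q v ≤ wcpThreshold w ρ q + x / √(nEff w) := by
  rw [postError, ← le_div_iff₀' (Real.sqrt_pos.2 (nEff_pos hw)), sub_le_iff_le_add']

lemma measurable_postError (w ρ : Fin n → ℝ) (q : ℝ) : Measurable (postError w ρ q) :=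
  ((measurable_postThreshold ρ q).sub_const _).const_mul _

lemma one_sub_le_posterior_real_abs_postError_le (hw : ∀ i, 0 < w i) (hc : 0 < c)
    (ρ : Fin n → ℝ) (hq0 : 0 < q) (hq1 : q ≤ 1) (hx : 0 < x)
    (hne : ∀ y ∈ ({x, -x} : Set ℝ),
      weightedCDF w ρ (wcpThreshold w ρ q + y / √(nEff w)) ≠ q) :
    1 - (1 / (weightedCDF w ρ (wcpThreshold w ρ q + x / √(nEff w)) - q) ^ 2 / c
        + 1 / (weightedCDF w ρ (wcpThreshold w ρ q + -x / √(nEff w)) - q) ^ 2 / c)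
      ≤ (posterior ρ w c).real {v | |postError w ρ q v| ≤ x} := by
  have := isProbabilityMeasure_posterior hw hc ρ
  set A := fun y => {v | ¬(postThreshold ρ q v ≤ wcpThreshold w ρ q + y / √(nEff w) ↔
    wcpThreshold w ρ q ≤ wcpThreshold w ρ q + y / √(nEff w))}
  have hA (y : ℝ) (hy : y ∈ ({x, -x} : Set ℝ)) :=
    posterior_real_not_postThreshold_le_iff_le hw hc ρ hq0 hq1 (hne y hy)
  have hmeas : MeasurableSet {v | |postError w ρ q v| ≤ x} :=
    measurableSet_le (measurable_postError w ρ q).abs measurable_const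
  have hsub : {v | |postError w ρ q v| ≤ x}ᶜ ⊆ A x ∪ A (-x) := by
    intro v (hv : ¬ |postError w ρ q v| ≤ x)
    have hn := Real.sqrt_pos.2 (nEff_pos hw)
    simp only [A, ← postError_le_iff hw, le_add_iff_nonneg_right, le_div_iff₀ hn, zero_mul,
      Set.mem_union, Set.mem_ofPred_eq, Left.nonneg_neg_iff]
    rcases lt_abs.1 (not_le.1 hv) with h | h
    · exact Or.inl fun h' => h.not_ge (h'.2 hx.le)
    · exact Or.inr fun h' => hx.not_ge (h'.1 (le_neg_of_le_neg h.le))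
  rw [← compl_compl {v | |postError w ρ q v| ≤ x}, probReal_compl_eq_one_sub hmeas.compl]
  exact sub_le_sub_left ((measureReal_mono hsub).trans ((measureReal_union_le _ _).trans
    (add_le_add (hA x (Or.inl rfl)) (hA (-x) (Or.inr rfl))))) 1

lemma posterior_real_abs_postError_le_le (hw : ∀ i, 0 < w i) (hc : 0 < c) (ρ : Fin n → ℝ)
    (hq0 : 0 < q) (hq1 : q < 1) {y η : ℝ} (hyx : y < -x) (hx : 0 ≤ x)
    (hy : weightedCDF w ρ (wcpThreshold w ρ q + y / √(nEff w)) ∈ Set.Ioo (0 : ℝ) 1)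
    (hη : 0 < η) (hηq : η < q) :
    (posterior ρ w c).real {v | |postError w ρ q v| ≤ x}
      ≤ (weightedCDF w ρ (wcpThreshold w ρ q + x / √(nEff w))
          - weightedCDF w ρ (wcpThreshold w ρ q + y / √(nEff w))) / η
        + √c * Real.exp (1 / 2) * (η / ((1 - q) * (q - η))) := by
  have := isProbabilityMeasure_posterior hw hc ρ
  refine le_trans (measureReal_mono fun v (hv : |postError w ρ q v| ≤ x) => ?_)
    (posterior_real_postThreshold_mem_Ioc_le hw hc ρ hq0 hq1 (by gcongr; linarith) hy hη hηq)
  rw [abs_le] at hv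
  exact ⟨not_le.1 (mt (postError_le_iff hw).2 (not_le.2 (hyx.trans_le hv.1))),
    (postError_le_iff hw).1 hv.2⟩

-- The mass `η = u / √(c + 1)` makes both terms of the preceding bound of order `u`.
lemma posterior_real_abs_postError_le_le_mul_add (hw : ∀ i, 0 < w i) (hc : 0 < c) (ρ : Fin n → ℝ)
    (hq0 : 0 < q) (hq1 : q < 1) {y u : ℝ} (hyx : y < -x) (hx : 0 ≤ x)
    (hy : weightedCDF w ρ (wcpThreshold w ρ q + y / √(nEff w)) ∈ Set.Ioo (0 : ℝ) 1)
    (hu : 0 < u) (huq : u < q) (hu_sq : u ^ 2 = √((c + 1) / nEff w)) :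
    (posterior ρ w c).real {v | |postError w ρ q v| ≤ x}
      ≤ √(nEff w) * (weightedCDF w ρ (wcpThreshold w ρ q + x / √(nEff w))
          - weightedCDF w ρ (wcpThreshold w ρ q + y / √(nEff w))) * u
        + Real.exp (1 / 2) * (u / ((1 - q) * (q - u))) := by
  have hc1 : 1 ≤ √(c + 1) := Real.one_le_sqrt.2 (by linarith)
  have hηu : u / √(c + 1) ≤ u := div_le_self hu.le hc1
  refine (posterior_real_abs_postError_le_le hw hc ρ hq0 hq1 hyx hx hy (by positivity)
    (hηu.trans_lt huq)).trans (add_le_add (le_of_eq ?_) ?_)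
  · have hn := Real.sqrt_pos.2 (nEff_pos hw)
    rw [Real.sqrt_div (by positivity), eq_div_iff hn.ne'] at hu_sq
    rw [← hu_sq]
    field_simp
  · calc √c * Real.exp (1 / 2) * (u / √(c + 1) / ((1 - q) * (q - u / √(c + 1))))
        = Real.exp (1 / 2) * (√c / √(c + 1) * u / ((1 - q) * (q - u / √(c + 1)))) := by ring
      _ ≤ Real.exp (1 / 2) * (u / ((1 - q) * (q - u))) := by
        have hcle : √c / √(c + 1) ≤ 1 := by
          rw [div_le_one (by positivity)]
          exact Real.sqrt_le_sqrt (by linarith)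
        have := sub_pos.2 hq1
        have := sub_pos.2 huq
        gcongr
        exact mul_le_of_le_one_left hu.le hcle

end PostError

section PosteriorAsymptotics

variable {m : ℕ → ℕ} [∀ k, NeZero (m k)] {w : ∀ k, Fin (m k) → ℝ} {P : Measure ℝ}
  [IsProbabilityMeasure P] {θ f : ℝ} {c : ℕ → ℝ}

lemma tendsto_weightedCDF_wcpThreshold_add (hw : ∀ k i, 0 < w k i)
    (hneff : Tendsto (fun k => nEff (w k)) atTop atTop) (hθ0 : 0 < cdf P θ)
    (hf : 0 < f) (hF : HasDerivAt (cdf P) f θ) (x : ℝ) :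
    Tendsto (fun s : Σ k, Fin (m k) → ℝ => weightedCDF (w s.1) s.2
        (wcpThreshold (w s.1) s.2 (cdf P θ) + x / √(nEff (w s.1))))
      (highProb fun k => sampling (m k) P) (𝓝 (cdf P θ)) :=
  tendsto_of_tendsto_sqrt_mul_sub (hneff.comp tendsto_fst_highProb)
    (tendsto_scaled_weightedCDF_wcpThreshold_add hw hneff hθ0 hf hF x)

lemma tendstoInProb_posterior_postError_le (hw : ∀ k i, 0 < w k i)
    (hneff : Tendsto (fun k => nEff (w k)) atTop atTop) (hθ0 : 0 < cdf P θ) (hθ1 : cdf P θ < 1)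
    (hf : 0 < f) (hF : HasDerivAt (cdf P) f θ) (hc : ∀ k, 0 < c k) {κ : ℝ} (hκ : 0 < κ)
    (hratio : Tendsto (fun k => c k / nEff (w k)) atTop (𝓝 κ)) (x : ℝ) :
    TendstoInProb m P (fun k ρ => (posterior ρ (w k) (c k)).real
        {v | postError (w k) ρ (cdf P θ) v ≤ x})
      ((gaussianReal 0 (cdf P θ * (1 - cdf P θ) / (κ * f ^ 2)).toNNReal).real (Set.Iic x)) := by
  set q := cdf P θ
  have hctop : Tendsto c atTop atTop :=
    (hratio.pos_mul_atTop hκ hneff).congr fun k => div_mul_cancel₀ _ (nEff_pos (hw k)).ne'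
  have hsqrt : Tendsto (fun k => √(c k / nEff (w k))) atTop (𝓝 √κ) := hratio.sqrt
  have hp := tendsto_weightedCDF_wcpThreshold_add hw hneff hθ0 hf hF x
  have hscaled := ((hsqrt.comp (tendsto_fst_highProb (μ := fun k => sampling (m k) P))).mul
    (tendsto_scaled_weightedCDF_wcpThreshold_add hw hneff hθ0 hf hF x)).congr fun s => by
      have hn := nEff_pos (hw s.1)
      rw [Function.comp_apply, ← mul_assoc, ← Real.sqrt_mul (div_nonneg (hc s.1).le hn.le),
        div_mul_cancel₀ _ hn.ne']
  have hbeta := tendsto_betaMeasure_real_Ici hθ0 hθ1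
    (hctop.comp (tendsto_fst_highProb (μ := fun k => sampling (m k) P))) hscaled
  rw [← mul_assoc, gaussianReal_real_Ici x (by positivity)
    (mul_nonneg hθ0.le (sub_nonneg.2 hθ1.le)), mul_pow, Real.sq_sqrt hκ.le] at hbeta
  refine tendstoInProb_iff.2 (hbeta.congr' ?_)
  filter_upwards [hp.eventually_mem (Ioo_mem_nhds hθ0 hθ1)] with s hs
  simp only [postError_le_iff (hw s.1)]
  exact (posterior_real_postThreshold_le (hw s.1) (hc s.1) s.2 hθ0 hθ1.le hs).symm

lemma tendstoInProb_posterior_abs_postError_le_one (hw : ∀ k i, 0 < w k i)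
    (hneff : Tendsto (fun k => nEff (w k)) atTop atTop) (hθ0 : 0 < cdf P θ)
    (hf : 0 < f) (hF : HasDerivAt (cdf P) f θ) (hc : ∀ k, 0 < c k)
    (hratio : Tendsto (fun k => c k / nEff (w k)) atTop atTop) {x : ℝ} (hx : 0 < x) :
    TendstoInProb m P (fun k ρ => (posterior ρ (w k) (c k)).real
      {v | |postError (w k) ρ (cdf P θ) v| ≤ x}) 1 := by
  set l := highProb fun k => sampling (m k) P
  set Z : ℝ → (Σ k, Fin (m k) → ℝ) → ℝ := fun y s => √(nEff (w s.1)) * (weightedCDF (w s.1) s.2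
    (wcpThreshold (w s.1) s.2 (cdf P θ) + y / √(nEff (w s.1))) - cdf P θ) with hZ_def
  have hZ (y : ℝ) : Tendsto (Z y) l (𝓝 (f * y)) :=
    tendsto_scaled_weightedCDF_wcpThreshold_add hw hneff hθ0 hf hF y
  have hZ_zero (y : ℝ) (hy : y ≠ 0) :
      Tendsto (fun s => 1 / Z y s ^ 2 / (c s.1 / nEff (w s.1))) l (𝓝 0) :=
    (tendsto_const_nhds.div ((hZ y).pow 2) (by positivity)).div_atTop
      (hratio.comp tendsto_fst_highProb)
  have hlower := ((hZ_zero x hx.ne').add (hZ_zero (-x) (neg_ne_zero.2 hx.ne'))).const_sub 1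
  rw [add_zero, sub_zero] at hlower
  refine tendstoInProb_iff.2 (tendsto_of_tendsto_of_tendsto_of_le_of_le' hlower
    tendsto_const_nhds ?_ (.of_forall fun s => ?_))
  · filter_upwards [(hZ x).eventually_ne (mul_pos hf hx).ne',
      (hZ (-x)).eventually_ne (mul_neg_of_pos_of_neg hf (neg_neg_of_pos hx)).ne] with s hsx hsx'
    have hn := nEff_pos (hw s.1)
    have hbound := one_sub_le_posterior_real_abs_postError_le (hw s.1) (hc s.1) s.2 hθ0
      (cdf_le_one P θ) hx ?_
    · refine le_trans (le_of_eq ?_) hbound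
      simp only [hZ_def, mul_pow, Real.sq_sqrt hn.le]
      field_simp
    · rintro y (rfl | rfl)
      · exact sub_ne_zero.1 (right_ne_zero_of_mul hsx)
      · exact sub_ne_zero.1 (right_ne_zero_of_mul hsx')
  · have := isProbabilityMeasure_posterior (hw s.1) (hc s.1) s.2
    exact measureReal_le_one

lemma tendstoInProb_posterior_abs_postError_le_zero (hw : ∀ k i, 0 < w k i)
    (hneff : Tendsto (fun k => nEff (w k)) atTop atTop) (hθ0 : 0 < cdf P θ) (hθ1 : cdf P θ < 1)
    (hf : 0 < f) (hF : HasDerivAt (cdf P) f θ) (hc : ∀ k, 0 < c k)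
    (hratio : Tendsto (fun k => c k / nEff (w k)) atTop (𝓝 0)) {x : ℝ} (hx : 0 ≤ x) :
    TendstoInProb m P (fun k ρ => (posterior ρ (w k) (c k)).real
      {v | |postError (w k) ρ (cdf P θ) v| ≤ x}) 0 := by
  set l := highProb fun k => sampling (m k) P
  set q := cdf P θ
  set Z : ℝ → (Σ k, Fin (m k) → ℝ) → ℝ := fun y s => √(nEff (w s.1)) * (weightedCDF (w s.1) s.2
    (wcpThreshold (w s.1) s.2 q + y / √(nEff (w s.1))) - q) with hZ_def
  have hZ (y : ℝ) : Tendsto (Z y) l (𝓝 (f * y)) :=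
    tendsto_scaled_weightedCDF_wcpThreshold_add hw hneff hθ0 hf hF y
  set u : (Σ k, Fin (m k) → ℝ) → ℝ := fun s => √√((c s.1 + 1) / nEff (w s.1))
  have hu : Tendsto u l (𝓝 0) := by
    have h := (hratio.add (hneff.const_div_atTop 1)).sqrt.sqrt
    simp only [add_zero, Real.sqrt_zero, ← add_div] at h
    exact h.comp tendsto_fst_highProb
  have hbound : Tendsto (fun s => (Z x s - Z (-x - 1) s) * u s
      + Real.exp (1 / 2) * (u s / ((1 - q) * (q - u s)))) l (𝓝 0) := by
    have hden : (1 - q) * (q - 0) ≠ 0 := by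
      rw [sub_zero]
      exact (mul_pos (sub_pos.2 hθ1) hθ0).ne'
    simpa only [Pi.div_apply, mul_zero, zero_div, add_zero] using
      (((hZ x).sub (hZ (-x - 1))).mul hu).add
        ((hu.div ((hu.const_sub q).const_mul (1 - q)) hden).const_mul (Real.exp (1 / 2)))
  refine tendstoInProb_iff.2 (tendsto_of_tendsto_of_tendsto_of_le_of_le' tendsto_const_nhds hbound
    (.of_forall fun s => measureReal_nonneg) ?_)
  filter_upwards [(tendsto_weightedCDF_wcpThreshold_add hw hneff hθ0 hf hF (-x - 1)).eventually_mem
    (Ioo_mem_nhds hθ0 hθ1), hu.eventually_lt_const hθ0] with s hs hus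
  have hr : 0 < (c s.1 + 1) / nEff (w s.1) :=
    div_pos (add_pos (hc s.1) one_pos) (nEff_pos (hw s.1))
  refine (posterior_real_abs_postError_le_le_mul_add (hw s.1) (hc s.1) s.2 hθ0 hθ1
    (sub_one_lt (-x)) hx hs (Real.sqrt_pos.2 (Real.sqrt_pos.2 hr)) hus
    (Real.sq_sqrt (Real.sqrt_nonneg _))).trans_eq ?_
  simp only [hZ_def, u, ← mul_sub, sub_sub_sub_cancel_right]

end PosteriorAsymptotics

end WBCP

theorem theorem1 (q : ℝ) (hq0 : 0 < q) (hq1 : q < 1) :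
    -- mean consistency
    (∀ (n : ℕ) [NeZero n] (ρ w : Fin n → ℝ), (∀ i, 0 < w i) →
      WBCP.weightedCDF w ρ (WBCP.wcpThreshold w ρ q) ≠ q →
      ∃ C : ℝ, ∀ c : ℝ, 0 < c →
        |(∫ v, WBCP.postThreshold ρ q v ∂(WBCP.posterior ρ w c)) - WBCP.wcpThreshold w ρ q|
          ≤ C / c) ∧
    -- posterior variance of the cumulative sums
    (∀ (n : ℕ) [NeZero n] (ρ w : Fin n → ℝ), (∀ i, 0 < w i) → ∀ c : ℝ, 0 < c → ∀ j : Fin n,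
      WBCP.postVar ρ w c j =
        WBCP.cumSum (WBCP.sortedWeight ρ w) j * (1 - WBCP.cumSum (WBCP.sortedWeight ρ w) j)
          / (c + 1)) ∧
    -- frequentist variance of the weighted empirical distribution function
    (∀ (n : ℕ) [NeZero n] (w : Fin n → ℝ), (∀ i, 0 < w i) →
      ∀ (P : Measure ℝ) [IsProbabilityMeasure P] (t : ℝ),
        WBCP.freqVar w P t = cdf P t * (1 - cdf P t) / WBCP.nEff w ∧
        ∀ (Q : Measure ℝ) [IsProbabilityMeasure Q],
          |WBCP.freqVar w P t - cdf Q t * (1 - cdf Q t) / WBCP.nEff w|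
            ≤ |cdf P t - cdf Q t| / WBCP.nEff w) ∧
    -- exact matching at a common level: `c = n_eff - 1`, and the error of `c = n_eff`
    (∀ (n : ℕ) [NeZero n] (ρ w : Fin n → ℝ), (∀ i, 0 < w i) →
      ∀ (P : Measure ℝ) [IsProbabilityMeasure P] (t : ℝ) (j : Fin n),
        0 < cdf P t → cdf P t < 1 → WBCP.cumSum (WBCP.sortedWeight ρ w) j = cdf P t →
        (∀ c : ℝ, 0 < c →
          (WBCP.postVar ρ w c j = WBCP.freqVar w P t ↔ c = WBCP.nEff w - 1) ∧
          (WBCP.postVar ρ w c j < WBCP.freqVar w P t ↔ WBCP.nEff w - 1 < c)) ∧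
        |WBCP.postVar ρ w (WBCP.nEff w) j - WBCP.freqVar w P t|
          ≤ WBCP.freqVar w P t / WBCP.nEff w) ∧
    -- asymptotics along any sequence of weight profiles with `n_eff → ∞`
    (∀ (m : ℕ → ℕ) [∀ k, NeZero (m k)] (w : ∀ k, Fin (m k) → ℝ), (∀ k i, 0 < w k i) →
      Tendsto (fun k => WBCP.nEff (w k)) atTop atTop →
      ∀ (P : Measure ℝ) [IsProbabilityMeasure P] (θ : ℝ), cdf P θ = q →
      -- asymptotic uniqueness of `c = n_eff` at the quantile
      (∀ (ρ : ∀ k, Fin (m k) → ℝ) (c : ℕ → ℝ), (∀ k, 0 < c k) →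
        (Tendsto (fun k =>
            WBCP.postVar (ρ k) (w k) (c k)
                (WBCP.firstCrossing q (WBCP.sortedWeight (ρ k) (w k)))
              / WBCP.freqVar (w k) P θ) atTop (𝓝 1) ↔
          Tendsto (fun k => c k / WBCP.nEff (w k)) atTop (𝓝 1))) ∧
      -- Bernstein–von Mises alignment, for a score density `f > 0` at the quantile `θ`
      ∀ f : ℝ, 0 < f → HasDerivAt (cdf P) f θ →
        -- sampling distribution of the weighted sample quantile
        WBCP.HasAsymptoticVariance m P (fun k => WBCP.freqError (w k) q θ)
          (q * (1 - q) / f ^ 2) ∧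
        ((∀ ε > 0, ∀ᶠ k in atTop, ∀ i, √(WBCP.nEff (w k)) * WBCP.normWeight (w k) i ≤ ε) →
          ∀ x : ℝ, Tendsto (fun k =>
              (WBCP.sampling (m k) P).real {ρ | WBCP.freqError (w k) q θ ρ ≤ x}) atTop
            (𝓝 ((gaussianReal 0 (q * (1 - q) / f ^ 2).toNNReal).real (Set.Iic x)))) ∧
        -- posterior distribution with `c = n_eff`
        (∀ x : ℝ, WBCP.TendstoInProb m P (fun k ρ =>
            (WBCP.posterior ρ (w k) (WBCP.nEff (w k))).real {v | WBCP.postError (w k) ρ q v ≤ x})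
          ((gaussianReal 0 (q * (1 - q) / f ^ 2).toNNReal).real (Set.Iic x))) ∧
        -- posterior distribution with any other concentration
        ∀ c : ℕ → ℝ, (∀ k, 0 < c k) →
          (∀ κ : ℝ, 0 < κ → Tendsto (fun k => c k / WBCP.nEff (w k)) atTop (𝓝 κ) →
            ∀ x : ℝ, WBCP.TendstoInProb m P (fun k ρ =>
                (WBCP.posterior ρ (w k) (c k)).real {v | WBCP.postError (w k) ρ q v ≤ x})
              ((gaussianReal 0 (q * (1 - q) / (κ * f ^ 2)).toNNReal).real (Set.Iic x))) ∧
          (Tendsto (fun k => c k / WBCP.nEff (w k)) atTop atTop →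
            ∀ x : ℝ, 0 < x → WBCP.TendstoInProb m P (fun k ρ =>
                (WBCP.posterior ρ (w k) (c k)).real {v | |WBCP.postError (w k) ρ q v| ≤ x}) 1) ∧
          (Tendsto (fun k => c k / WBCP.nEff (w k)) atTop (𝓝 0) →
            ∀ x : ℝ, 0 < x → WBCP.TendstoInProb m P (fun k ρ =>
                (WBCP.posterior ρ (w k) (c k)).real {v | |WBCP.postError (w k) ρ q v| ≤ x}) 0)) := by
  refine ⟨fun n _ ρ w hw => WBCP.exists_abs_integral_postThreshold_sub_le hw ρ hq0 hq1.le,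
    fun n _ ρ w hw c hc j => WBCP.postVar_eq hw hc ρ j,
    fun n _ w hw P _ t => ⟨WBCP.freqVar_eq w P t, fun Q _ => WBCP.abs_freqVar_sub_le hw Q⟩,
    fun n _ ρ w hw P _ t j ht0 ht1 hj => ⟨fun c hc =>
      ⟨WBCP.postVar_eq_freqVar_iff hw hc ht0 ht1 hj, WBCP.postVar_lt_freqVar_iff hw hc ht0 ht1 hj⟩,
      WBCP.abs_postVar_nEff_sub_freqVar_le hw hj⟩, ?_⟩
  rintro m _ w hw hneff P _ θ rfl
  refine ⟨fun ρ c hc => WBCP.tendsto_postVar_div_freqVar_iff hw hneff hq0 hq1 ρ hc,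
    fun f hf hF => ?_⟩
  have hratio {c : ℕ → ℝ} (hc : ∀ k, 0 < c k) {κ : ℝ} (hκ : 0 < κ) :=
    WBCP.tendstoInProb_posterior_postError_le hw hneff hq0 hq1 hf hF hc hκ
  have hself : Tendsto (fun k => WBCP.nEff (w k) / WBCP.nEff (w k)) atTop (𝓝 1) :=
    tendsto_const_nhds.congr fun k => (div_self (WBCP.nEff_pos (hw k)).ne').symm
  refine ⟨WBCP.hasAsymptoticVariance_freqError hw hneff hq0 hf hF,
    fun hmax => WBCP.tendsto_sampling_real_freqError_le hw hmax hneff hq0 hq1 hf hF, ?_,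
    fun c hc => ⟨fun κ hκ => hratio hc hκ, fun h x hx =>
      WBCP.tendstoInProb_posterior_abs_postError_le_one hw hneff hq0 hf hF hc h hx,
    fun h x hx =>
      WBCP.tendstoInProb_posterior_abs_postError_le_zero hw hneff hq0 hq1 hf hF hc h hx.le⟩⟩
  simpa only [one_mul] using hratio (fun k => WBCP.nEff_pos (hw k)) one_pos hself
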